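/- Let $(M,g)$ be a time-oriented spacetime, that is, a smooth (Hausdorff, second countable, finite-dimensional) manifold $M$ without boundary with a smooth time-oriented Lorentzian metric $g$. A Cauchy surface for an open set $V\subset M$, regarded as a spacetime in its own right (in particular for $V=M$), is a relatively closed subset of $V$ that every inextendible causal curve of $V$ meets exactly once; $V$ is called globally hyperbolic if it has a Cauchy surface. Here a (future-directed) causal curve is a continuous curve, locally Lipschitz in charts, whose tangent vector is, at almost every parameter, nonzero, causal and future directed; it is an inextendible causal curve of $V$ if it lies in $V$ and has neither a future nor a past endpoint in $V$. **Lemma 3.1.** Suppose that $(M,g)$ is globally hyperbolic. Then there exist a Cauchy surface $\Sigma$ for $M$ and a sequence of compact sets $K_n\subset M$, $n\in\mathbb N$, such that, writing $V_n=\operatorname{int}(K_n)$: 1. $K_n\subset V_{n+1}$ for every $n$; 2. $\bigcup_n K_n=M$; 3. for every $n$, $V_n$ is globally hyperbolic and $\Sigma\cap V_n$ is a Cauchy surface for $V_n$. -/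

import Mathlib

open Set Filter Topology MeasureTheory Bundle
open scoped Manifold ContDiff

/-- A smooth Lorentzian metric of signature `(-, +, …, +)` on the boundaryless manifold `M` modelled
on the finite-dimensional real vector space `E`, together with a time orientation, given by a smooth
timelike vector field which is future directed by decree. -/
structure TimeOrientedLorentzMetric (E : Type*) [NormedAddCommGroup E] [NormedSpace ℝ E]
    (M : Type*) [TopologicalSpace M] [ChartedSpace E M] [IsManifold 𝓘(ℝ, E) ∞ M] where
  /-- The metric tensor, a bilinear form on each tangent space. -/
  metric (x : M) : TangentSpace 𝓘(ℝ, E) x →L[ℝ] TangentSpace 𝓘(ℝ, E) x →L[ℝ] ℝ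
  symm (x : M) (v w : TangentSpace 𝓘(ℝ, E) x) : metric x v w = metric x w v
  /-- Signature `(-, +, …, +)`: some vector is timelike, and the form is positive definite on its
  orthogonal complement. -/
  lorentzian (x : M) : ∃ u : TangentSpace 𝓘(ℝ, E) x, metric x u u < 0 ∧
    ∀ v : TangentSpace 𝓘(ℝ, E) x, metric x u v = 0 → v ≠ 0 → 0 < metric x v v
  /-- The metric is smooth as a section of the bundle of bilinear forms. -/
  contMDiff_metric : ContMDiff 𝓘(ℝ, E) (𝓘(ℝ, E).prod 𝓘(ℝ, E →L[ℝ] E →L[ℝ] ℝ)) ∞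
    (fun x : M ↦ TotalSpace.mk' (E →L[ℝ] E →L[ℝ] ℝ)
      (E := fun x : M ↦
        TangentSpace 𝓘(ℝ, E) x →L[ℝ] TangentSpace 𝓘(ℝ, E) x →L[ℝ] ℝ) x (metric x))
  /-- The vector field which fixes the time orientation. -/
  timeField (x : M) : TangentSpace 𝓘(ℝ, E) x
  timeField_timelike (x : M) : metric x (timeField x) (timeField x) < 0
  contMDiff_timeField : ContMDiff 𝓘(ℝ, E) 𝓘(ℝ, E).tangent ∞
    (fun x : M ↦ (⟨x, timeField x⟩ : TangentBundle 𝓘(ℝ, E) M))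

namespace TimeOrientedLorentzMetric

variable {E : Type*} [NormedAddCommGroup E] [NormedSpace ℝ E]
  {M : Type*} [TopologicalSpace M] [ChartedSpace E M] [IsManifold 𝓘(ℝ, E) ∞ M]

/-- A tangent vector is causal and future directed: it is timelike or null, and lies in the same
half of the cone as the time orientation. The strict inequality excludes the zero vector. -/
def FutureCausal (g : TimeOrientedLorentzMetric E M) (x : M) (v : TangentSpace 𝓘(ℝ, E) x) : Prop :=
  g.metric x v v ≤ 0 ∧ g.metric x (g.timeField x) v < 0

/-- A future directed causal curve, parametrized by the whole real line: a continuous curve, locally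
Lipschitz in charts, whose tangent vector exists and is causal and future directed at almost every
parameter. (Where `γ` is not differentiable, `mfderiv` is zero, and zero is not `FutureCausal`.
Curves on an open interval are covered by reparametrization.) -/
structure IsCausalCurve (g : TimeOrientedLorentzMetric E M) (γ : ℝ → M) : Prop where
  continuous : Continuous γ
  locallyLipschitz (t₀ : ℝ) :
    ∃ C, ∃ s ∈ 𝓝 t₀, LipschitzOnWith C (fun t ↦ chartAt E (γ t₀) (γ t)) s
  futureCausal : ∀ᵐ t : ℝ, g.FutureCausal (γ t) (mfderiv 𝓘(ℝ, ℝ) 𝓘(ℝ, E) γ t (1 : ℝ))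

/-- An inextendible causal curve of the open region `V`, regarded as a spacetime in its own right:
a causal curve inside `V` with neither a future nor a past endpoint in `V`. -/
structure IsInextendibleCausalCurve (g : TimeOrientedLorentzMetric E M) (V : Set M) (γ : ℝ → M) :
    Prop where
  isCausalCurve : g.IsCausalCurve γ
  mem (t : ℝ) : γ t ∈ V
  no_future_endpoint : ∀ p ∈ V, ¬ Tendsto γ atTop (𝓝 p)
  no_past_endpoint : ∀ p ∈ V, ¬ Tendsto γ atBot (𝓝 p)

/-- `S` is a Cauchy surface for the open region `V`, regarded as a spacetime in its own right:
a relatively closed subset of `V` which every inextendible causal curve of `V` meets exactly once,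
that is, at exactly one parameter value. For `V = univ` this is a Cauchy surface for the whole
spacetime. -/
structure IsCauchySurface (g : TimeOrientedLorentzMetric E M) (V S : Set M) : Prop where
  subset : S ⊆ V
  closed : closure S ∩ V ⊆ S
  meets_exactly_once (γ : ℝ → M) : g.IsInextendibleCausalCurve V γ → ∃! t : ℝ, γ t ∈ S

/-- The open region `V`, regarded as a spacetime in its own right, is globally hyperbolic: it
possesses a Cauchy surface. -/
def GloballyHyperbolic (g : TimeOrientedLorentzMetric E M) (V : Set M) : Prop :=
  ∃ S : Set M, g.IsCauchySurface V S

end TimeOrientedLorentzMetric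

/-! Any Cauchy surface `S` of `M` works. Exhaust `M` by relatively compact open sets `U`, and let
`surfaceInterior S U` consist of the points `p` for which J⁻(p) ∩ J⁺(S) and J⁺(p) ∩ J⁻(S) lie in
`U`. With a point, this set contains all its predecessors in J⁺(S), and dually. So an inextendible
curve of the set through a point of J⁺(S) that missed `S` would have no past endpoint in `M` either,
and would have to meet `S` after all (`exists_mem_of_past_convex`). Hence `S` cuts the set in a
Cauchy surface. The set is also the interior of its closure, because every neighbourhood of a point
contains an open set of later points. A subsequence of the closures is then the required exhaustion.

Openness of these sets, and the fact that they cover `M`, rest on the compactness of J⁻(p) ∩ J⁺(S),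
in the sequential form `IsCauchySurface.exists_limit`. No global limit curve is constructed. If
predecessors `q k` of points tending to `p` had no limit, the limits of points lying causally
between them and `p` would form a set that can be left towards the past, near every point, without
leaving the set itself. Iteration with steps of nearly maximal size gives a past inextendible curve
whose integer times lie in J⁺(S), which a Cauchy surface forbids.

The local input is `IsCausalBox.causalRel_of_tendsto`: in a small coordinate ball causal relations
pass to limits. Curves are reparametrized by a linear functional that is uniformly positive on the
cones. Their pointwise limits are Lipschitz, and the limit tangents are causal by cone duality
(`futureCausal_of_forall_dual`), since monotonicity of the dual functionals survives limits. -/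

namespace TimeOrientedLorentzMetric

/-! ### Lorentzian linear algebra: the future cone and its dual. -/

section Algebra

variable {E : Type*} [NormedAddCommGroup E] [NormedSpace ℝ E]
  {M : Type*} [TopologicalSpace M] [ChartedSpace E M] [IsManifold 𝓘(ℝ, E) ∞ M]
  (g : TimeOrientedLorentzMetric E M)

theorem metric_lin_comb (x : M) (a b : ℝ) (v w z : TangentSpace 𝓘(ℝ, E) x) :
    g.metric x (a • v + b • w) z = a * g.metric x v z + b * g.metric x w z := by
  simp

theorem metric_lin_comb_right (x : M) (a b : ℝ) (v w z : TangentSpace 𝓘(ℝ, E) x) :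
    g.metric x z (a • v + b • w) = a * g.metric x z v + b * g.metric x z w := by
  simp

theorem metric_lin_comb_self (x : M) (a b : ℝ) (v w : TangentSpace 𝓘(ℝ, E) x) :
    g.metric x (a • v + b • w) (a • v + b • w) =
      a ^ 2 * g.metric x v v + 2 * a * b * g.metric x v w + b ^ 2 * g.metric x w w := by
  rw [metric_lin_comb, metric_lin_comb_right, metric_lin_comb_right, g.symm x w v]
  ring

/-- The metric is positive definite on the orthogonal complement of a timelike vector. -/
theorem metric_pos_of_orthogonal {x : M} {X w : TangentSpace 𝓘(ℝ, E) x}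
    (hX : g.metric x X X < 0) (hw : g.metric x X w = 0) (hw0 : w ≠ 0) :
    0 < g.metric x w w := by
  obtain ⟨u, hu, hpos⟩ := g.lorentzian x
  by_contra! hle
  set β := g.metric x u X
  set α := g.metric x u w
  have hβ : β ≠ 0 := fun h ↦ by
    have hX0 : X ≠ 0 := by rintro rfl; simp at hX
    exact absurd (hpos X h hX0) (by linarith)
  -- This combination of the orthogonal vectors `w` and `X`, both of nonpositive square, has
  -- nonpositive square; being orthogonal to `u` it must vanish, which forces `α = 0` and then `w =
  -- 0`.
  have horth : g.metric x u (β • w + (-α) • X) = 0 := by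
    rw [metric_lin_comb_right]; simp only [α, β]; ring
  have hself := g.metric_lin_comb_self x β (-α) w X
  rw [g.symm x w X, hw] at hself
  by_cases h0 : β • w + (-α) • X = 0
  · rw [h0] at hself
    have hα : α = 0 := by
      have h1 : β ^ 2 * g.metric x w w ≤ 0 := mul_nonpos_of_nonneg_of_nonpos (sq_nonneg _) hle
      by_contra hne
      have h2 : α ^ 2 * g.metric x X X < 0 := mul_neg_of_pos_of_neg (by positivity) hX
      simp only [map_zero] at hself
      nlinarith
    rw [hα, neg_zero, zero_smul, add_zero] at h0
    exact hw0 ((smul_eq_zero.mp h0).resolve_left hβ)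
  · have := hpos _ horth h0
    nlinarith [mul_nonpos_of_nonneg_of_nonpos (sq_nonneg β) hle,
      mul_nonpos_of_nonneg_of_nonpos (sq_nonneg α) hX.le]

theorem metric_nonneg_of_orthogonal {x : M} {X w : TangentSpace 𝓘(ℝ, E) x}
    (hX : g.metric x X X < 0) (hw : g.metric x X w = 0) : 0 ≤ g.metric x w w := by
  rcases eq_or_ne w 0 with rfl | h
  · simp
  · exact (g.metric_pos_of_orthogonal hX hw h).le

/-- Cauchy-Schwarz on the orthogonal complement of a timelike vector. -/
theorem metric_sq_le_of_orthogonal {x : M} {X z y : TangentSpace 𝓘(ℝ, E) x}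
    (hX : g.metric x X X < 0) (hz : g.metric x X z = 0) (hy : g.metric x X y = 0) :
    g.metric x z y ^ 2 ≤ g.metric x z z * g.metric x y y := by
  have h := discrim_le_zero (a := g.metric x y y) (b := 2 * g.metric x z y)
    (c := g.metric x z z) fun t ↦ by
      have h1 := g.metric_lin_comb_self x 1 t z y
      have h2 : 0 ≤ g.metric x ((1 : ℝ) • z + t • y) ((1 : ℝ) • z + t • y) := by
        refine g.metric_nonneg_of_orthogonal hX ?_
        rw [metric_lin_comb_right, hz, hy]; ring
      nlinarith
  rw [discrim] at h
  nlinarith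

/-- Every vector splits into a multiple of a timelike vector and an orthogonal vector. -/
theorem exists_orthogonal_decomposition {x : M} {X : TangentSpace 𝓘(ℝ, E) x}
    (hX : g.metric x X X < 0) (v : TangentSpace 𝓘(ℝ, E) x) :
    ∃ (a : ℝ) (y : TangentSpace 𝓘(ℝ, E) x), v = a • X + (1 : ℝ) • y ∧ g.metric x X y = 0 := by
  refine ⟨g.metric x X v / g.metric x X X, v - (g.metric x X v / g.metric x X X) • X, ?_, ?_⟩
  · simp
  · rw [map_sub, map_smul, smul_eq_mul, div_mul_cancel₀ _ hX.ne, sub_self]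

/-- Equality in the second condition would put `v` into the spacelike complement of the time field.
Nonzero causal vectors are thus cut out by closed conditions, as compactness arguments on the unit
sphere need. -/
theorem futureCausal_of_nonpos {x : M} {v : TangentSpace 𝓘(ℝ, E) x} (hv : v ≠ 0)
    (h : g.metric x v v ≤ 0) (h' : g.metric x (g.timeField x) v ≤ 0) : g.FutureCausal x v :=
  ⟨h, h'.lt_of_ne fun h0 ↦
    h.not_gt (g.metric_pos_of_orthogonal (g.timeField_timelike x) h0 hv)⟩

theorem FutureCausal.ne_zero {g : TimeOrientedLorentzMetric E M} {x : M}
    {v : TangentSpace 𝓘(ℝ, E) x} (h : g.FutureCausal x v) : v ≠ 0 := by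
  rintro rfl
  simpa using h.2

/-- Reversed Cauchy-Schwarz: the functional dual to a future timelike vector is positive on
future causal vectors. -/
theorem neg_metric_pos_of_futureCausal {x : M} {z v : TangentSpace 𝓘(ℝ, E) x}
    (hz : g.metric x (g.timeField x) z = 0)
    (hzz : g.metric x z z < -g.metric x (g.timeField x) (g.timeField x))
    (hv : g.FutureCausal x v) : 0 < -g.metric x (g.timeField x + z) v := by
  have hX := g.timeField_timelike x
  obtain ⟨h1, h2⟩ := hv
  obtain ⟨a, y, rfl, hy⟩ := g.exists_orthogonal_decomposition hX v
  set X := g.timeField x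
  set m := -g.metric x X X with hm
  rw [metric_lin_comb_self, hy] at h1
  rw [metric_lin_comb_right, hy] at h2
  have ha : 0 < a := by nlinarith
  have hyy : g.metric x y y ≤ a ^ 2 * m := by simp only [hm]; nlinarith
  have hCS := g.metric_sq_le_of_orthogonal hX hz hy
  have hzy : g.metric x z y < a * m := by
    have hmp : 0 < m := by simp only [hm]; linarith
    have hz0 := g.metric_nonneg_of_orthogonal hX hz
    have hy0 := g.metric_nonneg_of_orthogonal hX hy
    refine lt_of_pow_lt_pow_left₀ 2 (by positivity) ?_
    calc g.metric x z y ^ 2 ≤ g.metric x z z * g.metric x y y := hCS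
      _ ≤ g.metric x z z * (a ^ 2 * m) := by gcongr
      _ < m * (a ^ 2 * m) := by gcongr
      _ = (a * m) ^ 2 := by ring
  have hexp : g.metric x (X + z) (a • X + (1 : ℝ) • y) = -(a * m) + g.metric x z y := by
    rw [show X + z = (1 : ℝ) • X + (1 : ℝ) • z by simp, metric_lin_comb, metric_lin_comb_right,
      metric_lin_comb_right, hy, g.symm x z X, hz]
    simp only [hm]; ring
  rw [hexp]; linarith

/-- The future causal cone is dual to the functionals which are positive on it. -/
theorem futureCausal_of_forall_dual {x : M} {v : E} (hv : v ≠ 0)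
    (h : ∀ l : E →L[ℝ] ℝ, (∀ w : E, g.FutureCausal x w → 0 < l w) → 0 ≤ l v) :
    g.FutureCausal x v := by
  have hX := g.timeField_timelike x
  -- The functionals `-g(X + z, ·)` with `X + z` future timelike suffice. Taking `z = b • y` along
  -- the spatial part of `v`, the slope `b = 0` fixes the time direction, and slopes with `b² g(y,
  -- y)` close to `m` give causality.
  have key : ∀ z : TangentSpace 𝓘(ℝ, E) x, g.metric x (g.timeField x) z = 0 →
      g.metric x z z < -g.metric x (g.timeField x) (g.timeField x) →
      0 ≤ -g.metric x (g.timeField x + z) v := fun z hz hzz ↦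
    h (-(g.metric x (g.timeField x + z) : E →L[ℝ] ℝ))
      fun w hw ↦ g.neg_metric_pos_of_futureCausal hz hzz hw
  obtain ⟨a, y, hvy, hy⟩ := g.exists_orthogonal_decomposition hX v
  have hv' : v = (a • g.timeField x + (1 : ℝ) • y : TangentSpace 𝓘(ℝ, E) x) := hvy
  set X := g.timeField x
  set m := -g.metric x X X with hm
  have hmp : 0 < m := by simp only [hm]; linarith
  have key' : ∀ b : ℝ, b ^ 2 * g.metric x y y < m → b * g.metric x y y ≤ a * m := by
    intro b hb
    have h1 := key (b • y) (by simp [hy]) (by simpa [pow_two, mul_assoc] using hb)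
    rw [hvy, show X + b • y = (1 : ℝ) • X + b • y by simp, metric_lin_comb,
      metric_lin_comb_right, metric_lin_comb_right, hy, g.symm x y X, hy] at h1
    simp only [hm]; linarith
  have ha : 0 ≤ a := by
    have := key' 0 (by simpa using hmp)
    nlinarith
  have hy0 := g.metric_nonneg_of_orthogonal hX hy
  have hle : g.metric x y y ≤ a ^ 2 * m := by
    by_contra! hlt
    have hyp : 0 < g.metric x y y := lt_of_le_of_lt (by positivity) hlt
    -- an intermediate slope violates `key'`
    have hs : a * m / g.metric x y y < √(m / g.metric x y y) := by
      apply Real.lt_sqrt_of_sq_lt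
      rw [div_pow, div_lt_div_iff₀ (by positivity) hyp]
      nlinarith [mul_pos hmp hyp]
    obtain ⟨b, hb1, hb2⟩ := exists_between hs
    have hb0 : 0 ≤ b := le_trans (by positivity) hb1.le
    have h3 : b ^ 2 < m / g.metric x y y := by
      rw [← Real.lt_sqrt hb0]; exact hb2
    have h4 := key' b (by rwa [lt_div_iff₀ hyp] at h3)
    rw [div_lt_iff₀ hyp] at hb1
    linarith
  refine g.futureCausal_of_nonpos hv ?_ ?_
  · rw [hvy, metric_lin_comb_self, hy]; simp only [hm] at hle; nlinarith
  · change g.metric x X v ≤ 0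
    rw [hvy, metric_lin_comb_right, hy]; simp only [hm] at hmp; nlinarith

end Algebra

end TimeOrientedLorentzMetric

namespace TimeOrientedLorentzMetric

/-! ### Cones at nearby points, compared in one chart. -/

section Coordinates

variable {E : Type*} [NormedAddCommGroup E] [NormedSpace ℝ E]
  {M : Type*} [TopologicalSpace M] [ChartedSpace E M] [IsManifold 𝓘(ℝ, E) ∞ M]

/-- The differential at `y` of the chart at `x`, with values in the model space. -/
noncomputable def chartDeriv (E : Type*) [NormedAddCommGroup E] [NormedSpace ℝ E]
    {M : Type*} [TopologicalSpace M] [ChartedSpace E M] (x y : M)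
    (v : TangentSpace 𝓘(ℝ, E) y) : E :=
  mfderiv 𝓘(ℝ, E) 𝓘(ℝ, E) (extChartAt 𝓘(ℝ, E) x) y v

omit [IsManifold 𝓘(ℝ, E) ∞ M] in
theorem isManifold_one [IsManifold 𝓘(ℝ, E) ∞ M] : IsManifold 𝓘(ℝ, E) 1 M :=
  IsManifold.of_le (n := ∞) (by simp)

theorem chartDeriv_self (x : M) (v : E) : chartDeriv E x x v = v := by
  have : IsManifold 𝓘(ℝ, E) 1 M := isManifold_one
  exact DFunLike.congr_fun (mfderiv_extChartAt_self (I := 𝓘(ℝ, E)) (x := x)) v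

theorem chartDeriv_eq_trivializationAt {x y : M} (hy : y ∈ (chartAt E x).source)
    (v : TangentSpace 𝓘(ℝ, E) y) : chartDeriv E x y v =
      (trivializationAt E (TangentSpace 𝓘(ℝ, E) : M → Type _) x).continuousLinearMapAt ℝ y v := by
  have : IsManifold 𝓘(ℝ, E) 1 M := isManifold_one
  rw [TangentBundle.continuousLinearMapAt_trivializationAt hy]
  rfl

/-- The time orientation at `x`, read in the chart at `x`. -/
def timeVector (g : TimeOrientedLorentzMetric E M) (x : M) : E := g.timeField x

/-- Smoothness of the bundle sections is used only here, and only as continuity at `x` of their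
coordinate expressions, so that cones at varying points become subsets of the fixed space `E`. -/
theorem exists_coordinate_representation (g : TimeOrientedLorentzMetric E M) (x : M) :
    ∃ (G : M → E →L[ℝ] E →L[ℝ] ℝ) (T : M → E), ContinuousAt G x ∧ ContinuousAt T x ∧
      ∀ y ∈ (chartAt E x).source, T y = chartDeriv E x y (g.timeField y) ∧
        ∀ v w : TangentSpace 𝓘(ℝ, E) y,
          g.metric y v w = G y (chartDeriv E x y v) (chartDeriv E x y w) := by
  have : IsManifold 𝓘(ℝ, E) 1 M := isManifold_one
  refine ⟨fun y ↦ ContinuousLinearMap.inCoordinates E (TangentSpace 𝓘(ℝ, E) : M → Type _)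
      (E →L[ℝ] ℝ) (fun x : M ↦ TangentSpace 𝓘(ℝ, E) x →L[ℝ] ℝ) x y x y (g.metric y),
    fun y ↦ (trivializationAt E (TangentSpace 𝓘(ℝ, E) : M → Type _) x ⟨y, g.timeField y⟩).2,
    ?_, ?_, ?_⟩
  · have W := g.contMDiff_metric.continuous.continuousAt (x := x)
    simp only [continuousAt_hom_bundle] at W
    exact W.2
  · have W := g.contMDiff_timeField.continuous.continuousAt (x := x)
    rw [FiberBundle.continuousAt_totalSpace] at W
    exact W.2
  · intro y hy
    have hy' : y ∈ (trivializationAt E (TangentSpace 𝓘(ℝ, E) : M → Type _) x).baseSet := hy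
    have hv (v : TangentSpace 𝓘(ℝ, E) y) :
        (trivializationAt E (TangentSpace 𝓘(ℝ, E) : M → Type _) x).symm y (chartDeriv E x y v)
          = v := by
      rw [chartDeriv_eq_trivializationAt hy]
      convert! ((trivializationAt E (TangentSpace 𝓘(ℝ, E) : M → Type _)
        x).continuousLinearEquivAt ℝ _ hy').symm_apply_apply v
      simp [Trivialization.coe_continuousLinearEquivAt_eq _ hy']
    refine ⟨?_, fun v w ↦ ?_⟩
    · rw [chartDeriv_eq_trivializationAt hy, Trivialization.continuousLinearMapAt_apply,
        Trivialization.coe_linearMapAt_of_mem _ hy']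
    · rw [inCoordinates_apply_eq₂ hy' hy' (Set.mem_univ _), hv, hv]
      simp only [Trivial.fiberBundle_trivializationAt', Trivial.linearMapAt_trivialization,
        LinearMap.id_coe, id_eq]

/-- Near `x`, chart vectors close to the time orientation at `x` are future directed causal. -/
theorem eventually_futureCausal_of_near (g : TimeOrientedLorentzMetric E M) (x : M) :
    ∃ δ > 0, ∀ᶠ y in 𝓝 x, ∀ v : TangentSpace 𝓘(ℝ, E) y,
      ‖chartDeriv E x y v - g.timeVector x‖ < δ → g.FutureCausal y v := by
  obtain ⟨G, T, hG, hT, h⟩ := g.exists_coordinate_representation x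
  have hx := mem_chart_source E x
  have hTx : T x = g.timeVector x := by rw [(h x hx).1]; exact chartDeriv_self x _
  have hGx (v w : E) : G x v w = g.metric x v w := by
    rw [(h x hx).2 v w, chartDeriv_self x v, chartDeriv_self x w]
  have hGT (w : E) : G x (T x) w = g.metric x (g.timeField x) w := by
    rw [hTx, hGx]; rfl
  have hfst : ContinuousAt (fun p : M × E ↦ G p.1) (x, g.timeVector x) :=
    hG.comp_of_eq continuousAt_fst rfl
  have hTf : ContinuousAt (fun p : M × E ↦ T p.1) (x, g.timeVector x) :=
    hT.comp_of_eq continuousAt_fst rfl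
  have h1 : ContinuousAt (fun p : M × E ↦ G p.1 p.2 p.2) (x, g.timeVector x) :=
    (hfst.clm_apply continuousAt_snd).clm_apply continuousAt_snd
  have h2 : ContinuousAt (fun p : M × E ↦ G p.1 (T p.1) p.2) (x, g.timeVector x) :=
    (hfst.clm_apply hTf).clm_apply continuousAt_snd
  have hneg := g.timeField_timelike x
  have e1 := h1.eventually (gt_mem_nhds (show G x (g.timeVector x) (g.timeVector x) < 0 by
    rw [hGx]; exact hneg))
  have e2 := h2.eventually (gt_mem_nhds (show G x (T x) (g.timeVector x) < 0 by
    rw [hGT]; exact hneg))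
  have e := e1.and e2
  rw [nhds_prod_eq, Filter.eventually_prod_iff] at e
  obtain ⟨P, hP, Q, hQ, hPQ⟩ := e
  obtain ⟨δ, hδ, hball⟩ := Metric.eventually_nhds_iff_ball.1 hQ
  refine ⟨δ, hδ, ?_⟩
  filter_upwards [hP, (chartAt E x).open_source.mem_nhds hx] with y hPy hy v hv
  have := hPQ hPy (hball _ (mem_ball_iff_norm.2 hv))
  refine ⟨?_, ?_⟩
  · rw [(h y hy).2]; exact this.1.le
  · rw [(h y hy).2, ← (h y hy).1]; exact this.2

theorem chartDeriv_ne_zero {g : TimeOrientedLorentzMetric E M} {x y : M}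
    (hy : y ∈ (chartAt E x).source) {v : TangentSpace 𝓘(ℝ, E) y} (hv : g.FutureCausal y v) :
    chartDeriv E x y v ≠ 0 := by
  obtain ⟨G, T, -, -, h⟩ := g.exists_coordinate_representation x
  intro h0
  have := hv.2
  rw [(h y hy).2, h0] at this
  simp at this

/-- A linear functional which is positive on the future causal cone at `x` is, in the chart at `x`,
uniformly positive on the future causal cones at nearby points. -/
theorem eventually_dual_pos [FiniteDimensional ℝ E] (g : TimeOrientedLorentzMetric E M) (x : M)
    (l : E →L[ℝ] ℝ) (hl : ∀ w : E, g.FutureCausal x w → 0 < l w) :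
    ∃ κ > 0, ∀ᶠ y in 𝓝 x, ∀ v : TangentSpace 𝓘(ℝ, E) y, g.FutureCausal y v →
      κ * ‖chartDeriv E x y v‖ ≤ l (chartDeriv E x y v) := by
  obtain ⟨G, T, hG, hT, h⟩ := g.exists_coordinate_representation x
  have hx := mem_chart_source E x
  have hTx : T x = g.timeVector x := by rw [(h x hx).1]; exact chartDeriv_self x _
  have hGx (v w : E) : G x v w = g.metric x v w := by
    rw [(h x hx).2 v w, chartDeriv_self x v, chartDeriv_self x w]
  have hGT (w : E) : G x (T x) w = g.metric x (g.timeField x) w := by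
    rw [hTx, hGx]; rfl
  have hS : IsCompact (Metric.sphere (0 : E) 1) := isCompact_sphere 0 1
  have hC : IsCompact {w : E | w ∈ Metric.sphere (0 : E) 1 ∧
      (G x w w ≤ 0 ∧ G x (T x) w ≤ 0)} := by
    refine hS.inter_right (IsClosed.inter ?_ ?_)
    · exact isClosed_le (f := fun w ↦ G x w w) (by fun_prop) continuous_const
    · exact isClosed_le (f := fun w ↦ G x (T x) w) (by fun_prop) continuous_const
  have hpos : ∀ w ∈ {w : E | w ∈ Metric.sphere (0 : E) 1 ∧
      (G x w w ≤ 0 ∧ G x (T x) w ≤ 0)}, 0 < l w := by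
    rintro w ⟨hw, h1, h2⟩
    have hw0 : w ≠ 0 := by rintro rfl; simp at hw
    rw [hGx] at h1
    rw [hGT] at h2
    exact hl w (g.futureCausal_of_nonpos hw0 h1 h2)
  -- The closed cone meets the unit sphere in a compact set, on which `l` is at least `κ`; passing
  -- to `κ / 2` makes the bound strict, hence stable under perturbation of the base point.
  obtain ⟨κ, hκ, hκl⟩ := hC.exists_forall_le' l.continuous.continuousOn hpos
  refine ⟨κ / 2, by positivity, ?_⟩
  have key : ∀ᶠ y in 𝓝 x, ∀ w ∈ Metric.sphere (0 : E) 1,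
      0 < G y w w ∨ 0 < G y (T y) w ∨ κ / 2 < l w := by
    apply hS.eventually_forall_of_forall_eventually
    intro w hw
    have hfst : ContinuousAt (fun p : M × E ↦ G p.1) (x, w) :=
      hG.comp_of_eq continuousAt_fst rfl
    have hTf : ContinuousAt (fun p : M × E ↦ T p.1) (x, w) :=
      hT.comp_of_eq continuousAt_fst rfl
    have h1 : ContinuousAt (fun p : M × E ↦ G p.1 p.2 p.2) (x, w) :=
      (hfst.clm_apply continuousAt_snd).clm_apply continuousAt_snd
    have h2 : ContinuousAt (fun p : M × E ↦ G p.1 (T p.1) p.2) (x, w) :=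
      (hfst.clm_apply hTf).clm_apply continuousAt_snd
    have h3 : ContinuousAt (fun p : M × E ↦ l p.2) (x, w) :=
      l.continuous.continuousAt.comp continuousAt_snd
    by_cases hc1 : 0 < G x w w
    · exact (h1.eventually (lt_mem_nhds hc1)).mono fun p hp ↦ Or.inl hp
    by_cases hc2 : 0 < G x (T x) w
    · exact (h2.eventually (lt_mem_nhds hc2)).mono fun p hp ↦ Or.inr (Or.inl hp)
    have := hκl w ⟨hw, not_lt.1 hc1, not_lt.1 hc2⟩
    exact (h3.eventually (lt_mem_nhds (show κ / 2 < l w by linarith))).mono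
      fun p hp ↦ Or.inr (Or.inr hp)
  filter_upwards [key, (chartAt E x).open_source.mem_nhds hx] with y hy hys v hv
  have hne := chartDeriv_ne_zero hys hv
  set w := chartDeriv E x y v with hw
  have hn : 0 < ‖w‖ := norm_pos_iff.2 hne
  have hm1 : G y w w ≤ 0 := by rw [← (h y hys).2]; exact hv.1
  have hm2 : G y (T y) w ≤ 0 := by rw [(h y hys).1, ← (h y hys).2]; exact hv.2.le
  have hu := hy (‖w‖⁻¹ • w) (by simp [norm_smul, hn.ne'])
  simp only [map_smul, smul_apply, smul_eq_mul] at hu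
  have hinv : 0 < ‖w‖⁻¹ := inv_pos.2 hn
  rcases hu with hu | hu | hu
  · exact absurd hu (not_lt.2 (mul_nonpos_of_nonneg_of_nonpos hinv.le
      (mul_nonpos_of_nonneg_of_nonpos hinv.le hm1)))
  · exact absurd hu (not_lt.2 (mul_nonpos_of_nonneg_of_nonpos hinv.le hm2))
  · rw [inv_mul_eq_div, lt_div_iff₀ hn] at hu
    exact hu.le

end Coordinates

end TimeOrientedLorentzMetric

/-! ### Monotonicity from the sign of an almost everywhere derivative, through absolute continuity.
-/

theorem le_of_ae_deriv_nonneg {f : ℝ → ℝ} {a b : ℝ} (hab : a ≤ b)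
    (hf : LocallyLipschitzOn (Icc a b) f) (h : ∀ᵐ t, t ∈ Ioo a b → 0 ≤ deriv f t) :
    f a ≤ f b := by
  obtain ⟨K, hK⟩ := hf.exists_lipschitzOnWith_of_compact isCompact_Icc
  rw [← uIcc_of_le hab] at hK
  have hac := hK.absolutelyContinuousOnInterval
  rw [← sub_nonneg, ← hac.integral_deriv_eq_sub, intervalIntegral.integral_of_le hab,
    integral_Ioc_eq_integral_Ioo]
  exact integral_nonneg_of_ae ((ae_restrict_iff' measurableSet_Ioo).2 h)

theorem lt_of_ae_deriv_pos {f : ℝ → ℝ} {a b : ℝ} (hab : a < b)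
    (hf : LocallyLipschitzOn (Icc a b) f) (h : ∀ᵐ t, t ∈ Ioo a b → 0 < deriv f t) :
    f a < f b := by
  obtain ⟨K, hK⟩ := hf.exists_lipschitzOnWith_of_compact isCompact_Icc
  rw [← uIcc_of_le hab.le] at hK
  have hac := hK.absolutelyContinuousOnInterval
  have h' : ∀ᵐ t, t ∈ Ioc a b → 0 < deriv f t := by
    have hb : ∀ᵐ t : ℝ, t ≠ b := by simp [ae_iff, measure_singleton]
    filter_upwards [h, hb] with t ht htb hmem
    exact ht ⟨hmem.1, lt_of_le_of_ne hmem.2 htb⟩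
  rw [← sub_pos, ← hac.integral_deriv_eq_sub,
    intervalIntegral.integral_pos_iff_support_of_nonneg_ae' ?_ hac.intervalIntegrable_deriv]
  · refine ⟨hab, ?_⟩
    have : Ioc a b =ᵐ[volume] (Function.support (deriv f) ∩ Ioc a b : Set ℝ) := by
      filter_upwards [h'] with t ht
      apply propext
      exact ⟨fun hm ↦ ⟨(ht hm).ne', hm⟩, fun hm ↦ hm.2⟩
    rw [← measure_congr this]
    simp [hab]
  · rw [uIoc_of_le hab.le]
    exact (ae_restrict_iff' measurableSet_Ioc).2 (h'.mono fun t ht hm ↦ (ht hm).le)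

namespace TimeOrientedLorentzMetric

/-! ### Causal curves on intervals: gluing, reparametrization, local time functions. -/

section CausalOn

variable {E : Type*} [NormedAddCommGroup E] [NormedSpace ℝ E]
  {M : Type*} [TopologicalSpace M] [ChartedSpace E M] [IsManifold 𝓘(ℝ, E) ∞ M]

/-- A future directed causal curve parametrized by a set `I`, in practice an interval. -/
structure IsCausalOn (g : TimeOrientedLorentzMetric E M) (c : ℝ → M) (I : Set ℝ) : Prop where
  continuousOn : ContinuousOn c I
  locallyLipschitz : ∀ t₀ ∈ I,
    ∃ C, ∃ s ∈ 𝓝[I] t₀, LipschitzOnWith C (fun t ↦ chartAt E (c t₀) (c t)) s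
  futureCausal : ∀ᵐ t : ℝ, t ∈ interior I →
    g.FutureCausal (c t) (mfderiv 𝓘(ℝ, ℝ) 𝓘(ℝ, E) c t (1 : ℝ))

variable {g : TimeOrientedLorentzMetric E M} {c c' : ℝ → M} {I J : Set ℝ}

theorem isCausalOn_univ_iff : g.IsCausalOn c univ ↔ g.IsCausalCurve c := by
  constructor
  · rintro ⟨h1, h2, h3⟩
    exact ⟨continuousOn_univ.1 h1, fun t ↦ by simpa using h2 t (mem_univ t), by simpa using h3⟩
  · rintro ⟨h1, h2, h3⟩
    exact ⟨continuousOn_univ.2 h1, fun t _ ↦ by simpa using h2 t, by simpa using h3⟩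

theorem IsCausalOn.mono (h : g.IsCausalOn c I) (hJ : J ⊆ I) : g.IsCausalOn c J where
  continuousOn := h.continuousOn.mono hJ
  locallyLipschitz t ht := by
    obtain ⟨C, s, hs, hl⟩ := h.locallyLipschitz t (hJ ht)
    exact ⟨C, s, nhdsWithin_mono _ hJ hs, hl⟩
  futureCausal := h.futureCausal.mono fun t ht htJ ↦ ht (interior_mono hJ htJ)

theorem IsCausalOn.congr (h : g.IsCausalOn c I) (he : EqOn c' c I) : g.IsCausalOn c' I where
  continuousOn := h.continuousOn.congr he
  locallyLipschitz t ht := by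
    obtain ⟨C, s, hs, hl⟩ := h.locallyLipschitz t ht
    refine ⟨C, s ∩ I, inter_mem hs self_mem_nhdsWithin, ?_⟩
    rw [he ht]
    intro x hx y hy
    simp only [he hx.2, he hy.2]
    exact hl hx.1 hy.1
  futureCausal := by
    filter_upwards [h.futureCausal] with t ht htI
    have hev : c' =ᶠ[𝓝 t] c := by
      filter_upwards [mem_interior_iff_mem_nhds.1 htI] with s hs using he hs
    rw [hev.mfderiv_eq, hev.eq_of_nhds]
    exact ht htI

theorem lipschitzOnWith_union_of_le {F : Type*} [PseudoEMetricSpace F] {f : ℝ → F} {s t : Set ℝ}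
    {b : ℝ} {C : NNReal} (hs : s ⊆ Iic b) (ht : t ⊆ Ici b) (hbs : b ∈ s) (hbt : b ∈ t)
    (h1 : LipschitzOnWith C f s) (h2 : LipschitzOnWith C f t) : LipschitzOnWith C f (s ∪ t) := by
  have key : ∀ x ∈ s, ∀ y ∈ t, edist (f x) (f y) ≤ C * edist x y := by
    intro x hx y hy
    have hxb : x ≤ b := hs hx
    have hby : b ≤ y := ht hy
    calc edist (f x) (f y) ≤ edist (f x) (f b) + edist (f b) (f y) := edist_triangle _ _ _
      _ ≤ C * edist x b + C * edist b y := add_le_add (h1 hx hbs) (h2 hbt hy)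
      _ = C * (edist x b + edist b y) := by rw [mul_add]
      _ = C * edist x y := by
        congr 1
        rw [edist_dist, edist_dist, edist_dist, ← ENNReal.ofReal_add dist_nonneg dist_nonneg,
          Real.dist_eq, Real.dist_eq, Real.dist_eq, abs_of_nonpos (by linarith),
          abs_of_nonpos (by linarith), abs_of_nonpos (by linarith)]
        congr 1; ring
  rintro x (hx | hx) y (hy | hy)
  · exact h1 hx hy
  · exact key x hx y hy
  · rw [edist_comm, edist_comm x]; exact key y hy x hx
  · exact h2 hx hy

theorem nhdsWithin_union_eq_left {b t : ℝ} (hJ : J ⊆ Ici b) (ht : t < b) :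
    𝓝[I ∪ J] t = 𝓝[I] t := by
  rw [nhdsWithin_union, (notMem_closure_iff_nhdsWithin_eq_bot (s := J)).1, sup_bot_eq]
  exact fun h ↦ ht.not_ge (closure_minimal hJ isClosed_Ici h)

theorem nhdsWithin_union_eq_right {b t : ℝ} (hI : I ⊆ Iic b) (ht : b < t) :
    𝓝[I ∪ J] t = 𝓝[J] t := by
  rw [nhdsWithin_union, (notMem_closure_iff_nhdsWithin_eq_bot (s := I)).1, bot_sup_eq]
  exact fun h ↦ ht.not_ge (closure_minimal hI isClosed_Iic h)

/-- Concatenation: a curve which is causal on both sides of a parameter is causal. -/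
theorem IsCausalOn.union {b : ℝ} (h1 : g.IsCausalOn c I) (h2 : g.IsCausalOn c J) (hI : I ⊆ Iic b)
    (hJ : J ⊆ Ici b) (hbI : b ∈ I) (hbJ : b ∈ J) : g.IsCausalOn c (I ∪ J) where
  continuousOn t ht := by
    rcases lt_trichotomy t b with h | rfl | h
    · rw [ContinuousWithinAt, nhdsWithin_union_eq_left hJ h]
      exact h1.continuousOn t (ht.resolve_right fun h' ↦ h.not_ge (hJ h'))
    · exact (h1.continuousOn t hbI).union (h2.continuousOn t hbJ)
    · rw [ContinuousWithinAt, nhdsWithin_union_eq_right hI h]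
      exact h2.continuousOn t (ht.resolve_left fun h' ↦ h.not_ge (hI h'))
  locallyLipschitz t ht := by
    rcases lt_trichotomy t b with h | rfl | h
    · rw [nhdsWithin_union_eq_left hJ h]
      exact h1.locallyLipschitz t (ht.resolve_right fun h' ↦ h.not_ge (hJ h'))
    · obtain ⟨C₁, s₁, hs₁, hl₁⟩ := h1.locallyLipschitz t hbI
      obtain ⟨C₂, s₂, hs₂, hl₂⟩ := h2.locallyLipschitz t hbJ
      refine ⟨max C₁ C₂, (s₁ ∩ I) ∪ (s₂ ∩ J), ?_, ?_⟩
      · rw [nhdsWithin_union]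
        exact mem_sup.2 ⟨mem_of_superset (inter_mem hs₁ self_mem_nhdsWithin) subset_union_left,
          mem_of_superset (inter_mem hs₂ self_mem_nhdsWithin) subset_union_right⟩
      · exact lipschitzOnWith_union_of_le (inter_subset_right.trans hI)
          (inter_subset_right.trans hJ) ⟨mem_of_mem_nhdsWithin hbI hs₁, hbI⟩
          ⟨mem_of_mem_nhdsWithin hbJ hs₂, hbJ⟩
          ((hl₁.mono inter_subset_left).weaken (le_max_left _ _))
          ((hl₂.mono inter_subset_left).weaken (le_max_right _ _))
    · rw [nhdsWithin_union_eq_right hI h]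
      exact h2.locallyLipschitz t (ht.resolve_left fun h' ↦ h.not_ge (hI h'))
  futureCausal := by
    -- A corner at `b` is harmless, a single parameter being null.
    have hb : ∀ᵐ t : ℝ, t ≠ b := by simp [ae_iff, measure_singleton]
    filter_upwards [h1.futureCausal, h2.futureCausal, hb] with t ht1 ht2 hne ht
    rcases hne.lt_or_gt with h | h
    · refine ht1 (mem_interior_iff_mem_nhds.2 ?_)
      filter_upwards [mem_interior_iff_mem_nhds.1 ht, gt_mem_nhds h] with s hs hsb
      exact hs.resolve_right fun h' ↦ (show s < b from hsb).not_ge (hJ h')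
    · refine ht2 (mem_interior_iff_mem_nhds.2 ?_)
      filter_upwards [mem_interior_iff_mem_nhds.1 ht, lt_mem_nhds h] with s hs hsb
      exact hs.resolve_left fun h' ↦ (show b < s from hsb).not_ge (hI h')

/-- Otherwise `mfderiv` takes its default value zero, which is not in the cone. -/
theorem mdifferentiableAt_of_futureCausal {t : ℝ}
    (h : g.FutureCausal (c t) (mfderiv 𝓘(ℝ, ℝ) 𝓘(ℝ, E) c t (1 : ℝ))) :
    MDifferentiableAt 𝓘(ℝ, ℝ) 𝓘(ℝ, E) c t := by
  by_contra hn
  apply h.ne_zero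
  rw [mfderiv_zero_of_not_mdifferentiableAt hn]
  rfl

/-- Affine reparametrization of causal curves, from one metric to another one. -/
theorem IsCausalOn.comp_affine_of_forall {g' : TimeOrientedLorentzMetric E M}
    (h : g.IsCausalOn c I) {α : ℝ} (hα : α ≠ 0) (β : ℝ)
    (hg : ∀ x v, g.FutureCausal x v → g'.FutureCausal x (α • v)) :
    g'.IsCausalOn (fun t ↦ c (α * t + β)) ((fun t ↦ α * t + β) ⁻¹' I) := by
  have hA : Continuous fun t : ℝ ↦ α * t + β := by fun_prop
  have hLip : LipschitzWith ‖α‖₊ fun t : ℝ ↦ α * t + β := by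
    refine LipschitzWith.of_dist_le_mul fun x y ↦ ?_
    rw [Real.dist_eq, Real.dist_eq, show α * x + β - (α * y + β) = α * (x - y) by ring, abs_mul]
    rfl
  have hT (t : ℝ) : Tendsto (fun t : ℝ ↦ α * t + β) (𝓝[(fun t ↦ α * t + β) ⁻¹' I] t)
      (𝓝[I] (α * t + β)) :=
    hA.continuousWithinAt.tendsto_nhdsWithin fun _ hx ↦ hx
  refine ⟨h.continuousOn.comp hA.continuousOn fun _ ht ↦ ht, fun t ht ↦ ?_, ?_⟩
  · obtain ⟨C, s, hs, hl⟩ := h.locallyLipschitz (α * t + β) ht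
    refine ⟨C * ‖α‖₊, (fun t ↦ α * t + β) ⁻¹' s, hT t hs, ?_⟩
    exact hl.comp hLip.lipschitzOnWith fun _ hx ↦ hx
  · have hq : Measure.QuasiMeasurePreserving (fun t : ℝ ↦ α * t + β) := by
      refine ⟨hA.measurable, ?_⟩
      have : (fun t : ℝ ↦ α * t + β) = (fun t ↦ t + β) ∘ fun t ↦ α * t := rfl
      rw [this, ← Measure.map_map (by fun_prop) (by fun_prop), Real.map_volume_mul_left hα,
        Measure.map_smul, (measurePreserving_add_right volume β).map_eq]
      exact Measure.smul_absolutelyContinuous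
    filter_upwards [hq.ae h.futureCausal] with t ht hmem
    have hint : α * t + β ∈ interior I := by
      have hopen : IsOpenMap fun t : ℝ ↦ α * t + β :=
        ((Homeomorph.mulLeft₀ α hα).trans (Homeomorph.addRight β)).isOpenMap
      refine interior_maximal ?_ (hopen _ isOpen_interior) (mem_image_of_mem _ hmem)
      rintro _ ⟨s, hs, rfl⟩
      exact interior_subset (s := (fun t ↦ α * t + β) ⁻¹' I) hs
    have hc := ht hint
    have hd : HasDerivAt (fun t : ℝ ↦ α * t + β) α t := by
      simpa using ((hasDerivAt_id t).const_mul α).add_const β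
    have hm : HasMFDerivAt 𝓘(ℝ, ℝ) 𝓘(ℝ, ℝ) (fun t : ℝ ↦ α * t + β) t
        (ContinuousLinearMap.toSpanSingleton ℝ α) := hd.hasFDerivAt.hasMFDerivAt
    have hcomp := (mdifferentiableAt_of_futureCausal hc).hasMFDerivAt.comp t hm
    have he : mfderiv 𝓘(ℝ, ℝ) 𝓘(ℝ, E) (fun t ↦ c (α * t + β)) t (1 : ℝ) =
        α • mfderiv 𝓘(ℝ, ℝ) 𝓘(ℝ, E) c (α * t + β) (1 : ℝ) := by
      have h0 : mfderiv 𝓘(ℝ, ℝ) 𝓘(ℝ, E) (fun t ↦ c (α * t + β)) t = _ := hcomp.mfderiv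
      rw [h0]
      have h1 : (ContinuousLinearMap.toSpanSingleton ℝ α) (1 : ℝ) = α • (1 : ℝ) := by simp
      exact (congrArg (mfderiv 𝓘(ℝ, ℝ) 𝓘(ℝ, E) c (α * t + β)) h1).trans (map_smul _ _ _)
    rw [he]
    exact hg _ _ hc

theorem FutureCausal.smul {x : M} {v : TangentSpace 𝓘(ℝ, E) x} (hv : g.FutureCausal x v) {α : ℝ}
    (hα : 0 < α) : g.FutureCausal x (α • v) := by
  refine ⟨?_, ?_⟩
  · simp only [map_smul, smul_apply, smul_eq_mul]
    exact mul_nonpos_of_nonneg_of_nonpos hα.le (mul_nonpos_of_nonneg_of_nonpos hα.le hv.1)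
  · simp only [map_smul, smul_eq_mul]
    exact mul_neg_of_pos_of_neg hα hv.2

theorem IsCausalOn.comp_affine (h : g.IsCausalOn c I) {α : ℝ} (hα : 0 < α) (β : ℝ) :
    g.IsCausalOn (fun t ↦ c (α * t + β)) ((fun t ↦ α * t + β) ⁻¹' I) :=
  h.comp_affine_of_forall hα.ne' β fun _ _ hv ↦ hv.smul hα

/-- If `c` is Lipschitz near `t₀` in some chart, so is its composition with any `C¹` function. -/
theorem exists_lipschitzOnWith_comp {F : Type*} [NormedAddCommGroup F] [NormedSpace ℝ F]
    {f : M → F} {t₀ : ℝ} {x : M} (hc : ContinuousWithinAt c I t₀)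
    (hx : c t₀ ∈ (chartAt E x).source)
    (hl : ∃ C, ∃ s ∈ 𝓝[I] t₀, LipschitzOnWith C (fun t ↦ chartAt E x (c t)) s)
    (hf : ContMDiffAt 𝓘(ℝ, E) 𝓘(ℝ, F) 1 f (c t₀)) :
    ∃ C, ∃ s ∈ 𝓝[I] t₀, LipschitzOnWith C (fun t ↦ f (c t)) s := by
  have : IsManifold 𝓘(ℝ, E) 1 M := isManifold_one
  obtain ⟨C, s, hs, hl⟩ := hl
  have hleft : (chartAt E x).symm (chartAt E x (c t₀)) = c t₀ := (chartAt E x).left_inv hx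
  have hG : ContDiffAt ℝ 1 (f ∘ (chartAt E x).symm) (chartAt E x (c t₀)) := by
    rw [← contMDiffAt_iff_contDiffAt]
    refine ContMDiffAt.comp (I' := 𝓘(ℝ, E)) _ (by rwa [hleft]) ?_
    exact (contMDiffOn_chart_symm (I := 𝓘(ℝ, E))).contMDiffAt
      ((chartAt E x).open_target.mem_nhds ((chartAt E x).map_source hx))
  obtain ⟨K, u, hu, hK⟩ := hG.exists_lipschitzOnWith
  have hcont : ContinuousWithinAt (fun t ↦ chartAt E x (c t)) I t₀ :=
    ((chartAt E x).continuousAt hx).comp_continuousWithinAt hc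
  refine ⟨K * C, s ∩ ((fun t ↦ chartAt E x (c t)) ⁻¹' u ∩ c ⁻¹' (chartAt E x).source),
    inter_mem hs (inter_mem (hcont hu) (hc ((chartAt E x).open_source.mem_nhds hx))), ?_⟩
  have h1 : LipschitzOnWith (K * C) ((f ∘ (chartAt E x).symm) ∘ fun t ↦ chartAt E x (c t))
      (s ∩ ((fun t ↦ chartAt E x (c t)) ⁻¹' u ∩ c ⁻¹' (chartAt E x).source)) :=
    hK.comp (hl.mono inter_subset_left) fun t ht ↦ ht.2.1
  intro a ha b hb
  have := h1 ha hb
  simp only [Function.comp_apply, (chartAt E x).left_inv ha.2.2,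
    (chartAt E x).left_inv hb.2.2] at this
  exact this

theorem contMDiffAt_extChartAt_one {x y : M} (hy : y ∈ (chartAt E x).source) :
    ContMDiffAt 𝓘(ℝ, E) 𝓘(ℝ, E) 1 (extChartAt 𝓘(ℝ, E) x) y := by
  have : IsManifold 𝓘(ℝ, E) 1 M := isManifold_one
  exact contMDiffAt_extChartAt' hy

/-- The derivative in the chart at `x` of a curve is the image of its tangent vector. -/
theorem hasDerivAt_chart {t : ℝ} {x : M} (hx : c t ∈ (chartAt E x).source)
    (hc : MDifferentiableAt 𝓘(ℝ, ℝ) 𝓘(ℝ, E) c t) :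
    HasDerivAt (fun s ↦ extChartAt 𝓘(ℝ, E) x (c s))
      (chartDeriv E x (c t) (mfderiv 𝓘(ℝ, ℝ) 𝓘(ℝ, E) c t (1 : ℝ))) t := by
  have h1 := ((contMDiffAt_extChartAt_one hx).mdifferentiableAt one_ne_zero).hasMFDerivAt.comp t
    hc.hasMFDerivAt
  have key : ∀ L : ℝ →L[ℝ] E, HasMFDerivAt 𝓘(ℝ, ℝ) 𝓘(ℝ, E)
      (fun s ↦ extChartAt 𝓘(ℝ, E) x (c s)) t L →
      HasDerivAt (fun s ↦ extChartAt 𝓘(ℝ, E) x (c s)) (L 1) t := by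
    intro L hL
    have h2 : HasFDerivAt (fun s ↦ extChartAt 𝓘(ℝ, E) x (c s)) L t :=
      hasMFDerivAt_iff_hasFDerivAt.1 hL
    exact h2.hasDerivAt
  exact key _ h1

theorem IsCausalOn.locallyLipschitzOn_comp {F : Type*} [NormedAddCommGroup F] [NormedSpace ℝ F]
    (h : g.IsCausalOn c I) {f : M → F}
    (hf : ∀ t ∈ I, ContMDiffAt 𝓘(ℝ, E) 𝓘(ℝ, F) 1 f (c t)) :
    LocallyLipschitzOn I fun t ↦ f (c t) := fun t ht ↦
  exists_lipschitzOnWith_comp (h.continuousOn t ht) (mem_chart_source E (c t))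
    (h.locallyLipschitz t ht) (hf t ht)

theorem IsCausalOn.locallyLipschitzOn_dual (h : g.IsCausalOn c I) {x : M}
    (hI : MapsTo c I (chartAt E x).source) (l : E →L[ℝ] ℝ) :
    LocallyLipschitzOn I fun t ↦ l (extChartAt 𝓘(ℝ, E) x (c t)) :=
  h.locallyLipschitzOn_comp (f := fun y ↦ l (extChartAt 𝓘(ℝ, E) x y)) fun _ ht ↦
    (l.contDiff.contMDiff.contMDiffAt).comp _ (contMDiffAt_extChartAt_one (hI ht))

/-- Functionals nonnegative on the cones act as local time functions: the derivative of the
composite is almost everywhere the value of `l` on the tangent vector. -/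
theorem IsCausalOn.monotoneOn_dual (h : g.IsCausalOn c I) [I.OrdConnected] {x : M}
    (hI : MapsTo c I (chartAt E x).source) (l : E →L[ℝ] ℝ)
    (hl : ∀ t ∈ I, ∀ v : TangentSpace 𝓘(ℝ, E) (c t), g.FutureCausal (c t) v →
      0 ≤ l (chartDeriv E x (c t) v)) :
    MonotoneOn (fun t ↦ l (extChartAt 𝓘(ℝ, E) x (c t))) I := by
  intro a ha b hb hab
  have hsub : Icc a b ⊆ I := OrdConnected.out ‹_› ha hb
  refine le_of_ae_deriv_nonneg (f := fun t ↦ l (extChartAt 𝓘(ℝ, E) x (c t))) hab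
    ((h.locallyLipschitzOn_dual hI l).mono hsub) ?_
  filter_upwards [(h.mono hsub).futureCausal] with t ht htm
  have htI := hsub (Ioo_subset_Icc_self htm)
  rw [interior_Icc] at ht
  have hd := hasDerivAt_chart (hI htI) (mdifferentiableAt_of_futureCausal (ht htm))
  have hd' : HasDerivAt (fun s ↦ l (extChartAt 𝓘(ℝ, E) x (c s))) _ t :=
    l.hasFDerivAt.comp_hasDerivAt t hd
  rw [hd'.deriv]
  exact hl t htI _ (ht htm)

theorem IsCausalOn.strictMonoOn_dual (h : g.IsCausalOn c I) [I.OrdConnected] {x : M}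
    (hI : MapsTo c I (chartAt E x).source) (l : E →L[ℝ] ℝ)
    (hl : ∀ t ∈ I, ∀ v : TangentSpace 𝓘(ℝ, E) (c t), g.FutureCausal (c t) v →
      0 < l (chartDeriv E x (c t) v)) :
    StrictMonoOn (fun t ↦ l (extChartAt 𝓘(ℝ, E) x (c t))) I := by
  intro a ha b hb hab
  have hsub : Icc a b ⊆ I := OrdConnected.out ‹_› ha hb
  refine lt_of_ae_deriv_pos (f := fun t ↦ l (extChartAt 𝓘(ℝ, E) x (c t))) hab
    ((h.locallyLipschitzOn_dual hI l).mono hsub) ?_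
  filter_upwards [(h.mono hsub).futureCausal] with t ht htm
  have htI := hsub (Ioo_subset_Icc_self htm)
  rw [interior_Icc] at ht
  have hd := hasDerivAt_chart (hI htI) (mdifferentiableAt_of_futureCausal (ht htm))
  have hd' : HasDerivAt (fun s ↦ l (extChartAt 𝓘(ℝ, E) x (c s))) _ t :=
    l.hasFDerivAt.comp_hasDerivAt t hd
  rw [hd'.deriv]
  exact hl t htI _ (ht htm)

/-- In the chart, a causal curve is Lipschitz with respect to a uniformly positive functional. -/
theorem IsCausalOn.norm_sub_le_dual (h : g.IsCausalOn c I) [I.OrdConnected] {x : M}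
    (hI : MapsTo c I (chartAt E x).source) (l : E →L[ℝ] ℝ) {κ : ℝ} (hκ : 0 < κ)
    (hl : ∀ t ∈ I, ∀ v : TangentSpace 𝓘(ℝ, E) (c t), g.FutureCausal (c t) v →
      κ * ‖chartDeriv E x (c t) v‖ ≤ l (chartDeriv E x (c t) v))
    {s t : ℝ} (hs : s ∈ I) (ht : t ∈ I) (hst : s ≤ t) :
    κ * ‖extChartAt 𝓘(ℝ, E) x (c t) - extChartAt 𝓘(ℝ, E) x (c s)‖ ≤
      l (extChartAt 𝓘(ℝ, E) x (c t)) - l (extChartAt 𝓘(ℝ, E) x (c s)) := by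
  -- With `μ` norming the displacement, `l - κ • μ` is still nonnegative on the cones, so it
  -- increases along the curve.
  obtain ⟨μ, hμ, hμv⟩ := exists_dual_vector'' ℝ
    (extChartAt 𝓘(ℝ, E) x (c t) - extChartAt 𝓘(ℝ, E) x (c s))
  have hm := h.monotoneOn_dual hI (l - κ • μ) (fun r hr v hv ↦ by
    have h1 := hl r hr v hv
    have h2 : μ (chartDeriv E x (c r) v) ≤ ‖chartDeriv E x (c r) v‖ :=
      (le_abs_self _).trans ((μ.le_opNorm _).trans (by
        simpa using mul_le_mul_of_nonneg_right hμ (norm_nonneg _)))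
    simp only [sub_apply, smul_apply, smul_eq_mul]
    nlinarith) hs ht hst
  simp only [sub_apply, smul_apply, smul_eq_mul] at hm
  rw [map_sub] at hμv
  simp only [RCLike.ofReal_real_eq_id, id_eq] at hμv
  rw [← hμv]
  linarith

end CausalOn

end TimeOrientedLorentzMetric

namespace TimeOrientedLorentzMetric

/-! ### Coordinate balls with uniformly controlled cones. -/

section LocalBoxes

variable {E : Type*} [NormedAddCommGroup E] [NormedSpace ℝ E]
  {M : Type*} [TopologicalSpace M] [ChartedSpace E M] [IsManifold 𝓘(ℝ, E) ∞ M]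

/-- The points which the chart at `x` sends into the closed ball of radius `r` around `x`. -/
def chartClosedBall (E : Type*) [NormedAddCommGroup E] [NormedSpace ℝ E]
    {M : Type*} [TopologicalSpace M] [ChartedSpace E M] (x : M) (r : ℝ) : Set M :=
  (chartAt E x).source ∩ extChartAt 𝓘(ℝ, E) x ⁻¹' Metric.closedBall (extChartAt 𝓘(ℝ, E) x x) r

/-- The points which the chart at `x` sends into the open ball of radius `r` around `x`. -/
def chartBall (E : Type*) [NormedAddCommGroup E] [NormedSpace ℝ E]
    {M : Type*} [TopologicalSpace M] [ChartedSpace E M] (x : M) (r : ℝ) : Set M :=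
  (chartAt E x).source ∩ extChartAt 𝓘(ℝ, E) x ⁻¹' Metric.ball (extChartAt 𝓘(ℝ, E) x x) r

/-- A coordinate ball around `x` on which the future causal cones are uniformly positive for the
functional `l` and contain all vectors close to the time orientation at `x`. -/
structure IsCausalBox (g : TimeOrientedLorentzMetric E M) (x : M) (l : E →L[ℝ] ℝ)
    (κ δ R : ℝ) : Prop where
  κ_pos : 0 < κ
  δ_pos : 0 < δ
  R_pos : 0 < R
  subset_target : Metric.closedBall (extChartAt 𝓘(ℝ, E) x x) R ⊆ (extChartAt 𝓘(ℝ, E) x).target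
  dual_pos : ∀ y ∈ chartClosedBall E x R, ∀ v : TangentSpace 𝓘(ℝ, E) y, g.FutureCausal y v →
    κ * ‖chartDeriv E x y v‖ ≤ l (chartDeriv E x y v)
  futureCausal : ∀ y ∈ chartClosedBall E x R, ∀ v : TangentSpace 𝓘(ℝ, E) y,
    ‖chartDeriv E x y v - g.timeVector x‖ < δ → g.FutureCausal y v

omit [IsManifold 𝓘(ℝ, E) ∞ M] in
theorem isOpen_chartBall (x : M) (r : ℝ) : IsOpen (chartBall E x r) := by
  have h := (continuousOn_extChartAt (I := 𝓘(ℝ, E)) x).isOpen_inter_preimage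
    (isOpen_extChartAt_source x) (Metric.isOpen_ball (x := extChartAt 𝓘(ℝ, E) x x) (ε := r))
  rwa [extChartAt_source] at h

omit [IsManifold 𝓘(ℝ, E) ∞ M] in
theorem mem_chartBall_self (x : M) {r : ℝ} (hr : 0 < r) : x ∈ chartBall E x r :=
  ⟨mem_chart_source E x, by simpa using hr⟩

omit [IsManifold 𝓘(ℝ, E) ∞ M] in
theorem chartBall_subset_chartClosedBall (x : M) (r : ℝ) :
    chartBall E x r ⊆ chartClosedBall E x r :=
  fun _ h ↦ ⟨h.1, Metric.ball_subset_closedBall h.2⟩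

omit [IsManifold 𝓘(ℝ, E) ∞ M] in
theorem chartClosedBall_mono (x : M) {r s : ℝ} (h : r ≤ s) :
    chartClosedBall E x r ⊆ chartClosedBall E x s :=
  fun _ hy ↦ ⟨hy.1, Metric.closedBall_subset_closedBall h hy.2⟩

omit [IsManifold 𝓘(ℝ, E) ∞ M] in
/-- Chart neighbourhoods in terms of the distance in the chart. -/
theorem exists_pos_of_mem_nhds {x p : M} (hp : p ∈ (chartAt E x).source) {N : Set M}
    (hN : N ∈ 𝓝 p) : ∃ ρ > 0, ∀ y ∈ (chartAt E x).source,
      ‖extChartAt 𝓘(ℝ, E) x y - extChartAt 𝓘(ℝ, E) x p‖ < ρ → y ∈ N := by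
  have hp' : p ∈ (extChartAt 𝓘(ℝ, E) x).source := by rwa [extChartAt_source]
  have hc := continuousAt_extChartAt_symm' hp'
  rw [ContinuousAt, (extChartAt 𝓘(ℝ, E) x).left_inv hp'] at hc
  obtain ⟨ρ, hρ, h⟩ := Metric.mem_nhds_iff.1 (hc hN)
  refine ⟨ρ, hρ, fun y hy hyp ↦ ?_⟩
  have := h (mem_ball_iff_norm.2 hyp)
  rwa [mem_preimage, (extChartAt 𝓘(ℝ, E) x).left_inv (by rwa [extChartAt_source])] at this

omit [IsManifold 𝓘(ℝ, E) ∞ M] in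
theorem isCompact_chartClosedBall [FiniteDimensional ℝ E] {x : M} {r : ℝ}
    (h : Metric.closedBall (extChartAt 𝓘(ℝ, E) x x) r ⊆ (extChartAt 𝓘(ℝ, E) x).target) :
    IsCompact (chartClosedBall E x r) := by
  have : chartClosedBall E x r =
      (extChartAt 𝓘(ℝ, E) x).symm '' Metric.closedBall (extChartAt 𝓘(ℝ, E) x x) r := by
    rw [(extChartAt 𝓘(ℝ, E) x).symm_image_eq_source_inter_preimage h, extChartAt_source]
    rfl
  rw [this]
  exact (isCompact_closedBall _ _).image_of_continuousOn ((continuousOn_extChartAt_symm x).mono h)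

/-- Causal boxes exist, inside any given neighbourhood. -/
theorem exists_isCausalBox [FiniteDimensional ℝ E] (g : TimeOrientedLorentzMetric E M) (x : M)
    {W : Set M} (hW : W ∈ 𝓝 x) :
    ∃ l κ δ R, g.IsCausalBox x l κ δ R ∧ chartClosedBall E x R ⊆ W := by
  have hl : ∀ w : E, g.FutureCausal x w →
      0 < (-(g.metric x (g.timeField x + 0) : E →L[ℝ] ℝ)) w := fun w hw ↦
    g.neg_metric_pos_of_futureCausal (z := 0) (by simp)
      (by simpa using g.timeField_timelike x) hw
  obtain ⟨κ, hκ, hdual⟩ := g.eventually_dual_pos x _ hl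
  obtain ⟨δ, hδ, hfut⟩ := g.eventually_futureCausal_of_near x
  obtain ⟨ρ, hρ, hN⟩ := exists_pos_of_mem_nhds (mem_chart_source E x)
    (inter_mem hW (hdual.and hfut))
  obtain ⟨ρ', hρ', ht⟩ := Metric.mem_nhds_iff.1 (extChartAt_target_mem_nhds (I := 𝓘(ℝ, E)) x)
  have hR : 0 < min ρ ρ' / 2 := by positivity
  have hlt : min ρ ρ' / 2 < min ρ ρ' := half_lt_self (by positivity)
  have hmem : ∀ y ∈ chartClosedBall E x (min ρ ρ' / 2), y ∈ W ∩ {y |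
      (∀ v : TangentSpace 𝓘(ℝ, E) y, g.FutureCausal y v → κ * ‖chartDeriv E x y v‖ ≤
        (-(g.metric x (g.timeField x + 0) : E →L[ℝ] ℝ)) (chartDeriv E x y v)) ∧
      ∀ v : TangentSpace 𝓘(ℝ, E) y, ‖chartDeriv E x y v - g.timeVector x‖ < δ →
        g.FutureCausal y v} := fun y hy ↦
    hN y hy.1 ((mem_closedBall_iff_norm.1 hy.2).trans_lt (hlt.trans_le (min_le_left _ _)))
  exact ⟨_, κ, δ, min ρ ρ' / 2, ⟨hκ, hδ, hR,
    (Metric.closedBall_subset_ball (hlt.trans_le (min_le_right _ _))).trans ht,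
    fun y hy ↦ (hmem y hy).2.1, fun y hy ↦ (hmem y hy).2.2⟩, fun y hy ↦ (hmem y hy).1⟩

theorem IsCausalBox.dual_pos_strict {g : TimeOrientedLorentzMetric E M} {x : M} {l : E →L[ℝ] ℝ}
    {κ δ R : ℝ} (h : g.IsCausalBox x l κ δ R) {y : M} (hy : y ∈ chartClosedBall E x R)
    {v : TangentSpace 𝓘(ℝ, E) y} (hv : g.FutureCausal y v) : 0 < l (chartDeriv E x y v) :=
  (mul_pos h.κ_pos (norm_pos_iff.2 (chartDeriv_ne_zero hy.1 hv))).trans_le (h.dual_pos y hy v hv)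

end LocalBoxes

/-! ### Limits of causal curves inside a box. -/

section Limits

variable {E : Type*} [NormedAddCommGroup E] [NormedSpace ℝ E] [FiniteDimensional ℝ E]
  {M : Type*} [TopologicalSpace M] [ChartedSpace E M] [IsManifold 𝓘(ℝ, E) ∞ M]
  {g : TimeOrientedLorentzMetric E M}

omit [FiniteDimensional ℝ E] in
theorem mdifferentiableAt_of_chart {c : ℝ → M} {x : M} {t : ℝ}
    (hs : ∀ᶠ s in 𝓝 t, c s ∈ (chartAt E x).source)
    (hd : DifferentiableAt ℝ (fun s ↦ extChartAt 𝓘(ℝ, E) x (c s)) t) :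
    MDifferentiableAt 𝓘(ℝ, ℝ) 𝓘(ℝ, E) c t := by
  have : IsManifold 𝓘(ℝ, E) 1 M := isManifold_one
  have hmem : c t ∈ (extChartAt 𝓘(ℝ, E) x).source := by
    rw [extChartAt_source]; exact hs.self_of_nhds
  have h1 : MDifferentiableAt 𝓘(ℝ, E) 𝓘(ℝ, E) (extChartAt 𝓘(ℝ, E) x).symm
      (extChartAt 𝓘(ℝ, E) x (c t)) :=
    ((contMDiffOn_extChartAt_symm x).contMDiffAt
      (extChartAt_target_mem_nhds' ((extChartAt 𝓘(ℝ, E) x).map_source hmem))).mdifferentiableAt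
      one_ne_zero
  have h2 := h1.comp t (mdifferentiableAt_iff_differentiableAt.2 hd)
  refine h2.congr_of_eventuallyEq ?_
  filter_upwards [hs] with s hs
  exact ((extChartAt 𝓘(ℝ, E) x).left_inv (by rwa [extChartAt_source])).symm

/-- A criterion for causality which passes to limits: a curve whose coordinates are Lipschitz, which
advances uniformly along some functional, and along which all local time functions increase. -/
theorem isCausalOn_of_monotone_dual {d : ℝ → M} {x : M} {a b : ℝ} {C : NNReal}
    (hd : MapsTo d (Icc a b) (chartAt E x).source)
    (hl : LipschitzOnWith C (fun s ↦ extChartAt 𝓘(ℝ, E) x (d s)) (Icc a b))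
    (l : E →L[ℝ] ℝ) {A Δ : ℝ} (hΔ : Δ ≠ 0)
    (hA : ∀ s ∈ Icc a b, l (extChartAt 𝓘(ℝ, E) x (d s)) = A + s * Δ)
    (hm : ∀ t ∈ Ioo a b, ∀ m : E →L[ℝ] ℝ, (∀ w : E, g.FutureCausal (d t) w → 0 < m w) →
      ∃ u ∈ 𝓝 t, MonotoneOn (fun s ↦ m (extChartAt 𝓘(ℝ, E) (d t) (d s))) u) :
    g.IsCausalOn d (Icc a b) := by
  have hcont : ContinuousOn d (Icc a b) := by
    have h1 := (continuousOn_extChartAt_symm (I := 𝓘(ℝ, E)) x).comp hl.continuousOn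
      fun s hs ↦ (extChartAt 𝓘(ℝ, E) x).map_source (by rw [extChartAt_source]; exact hd hs)
    refine h1.congr fun s hs ↦ ?_
    exact ((extChartAt 𝓘(ℝ, E) x).left_inv (by rw [extChartAt_source]; exact hd hs)).symm
  refine ⟨hcont, fun t ht ↦ ?_, ?_⟩
  · exact exists_lipschitzOnWith_comp (f := extChartAt 𝓘(ℝ, E) (d t)) (hcont t ht) (hd ht)
      ⟨C, Icc a b, self_mem_nhdsWithin, hl⟩ (contMDiffAt_extChartAt_one (mem_chart_source E _))
  -- Rademacher's theorem in one variable supplies the tangent vector almost everywhere.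
  · filter_upwards [hl.ae_differentiableWithinAt_of_mem] with t ht htI
    rw [interior_Icc] at htI
    have hnhds : Icc a b ∈ 𝓝 t := Icc_mem_nhds htI.1 htI.2
    have hdiff : DifferentiableAt ℝ (fun s ↦ extChartAt 𝓘(ℝ, E) x (d s)) t :=
      (ht (Ioo_subset_Icc_self htI)).differentiableAt hnhds
    have hmd := mdifferentiableAt_of_chart (eventually_of_mem hnhds fun s hs ↦ hd hs) hdiff
    have hx := hasDerivAt_chart (hd (Ioo_subset_Icc_self htI)) hmd
    have hp := hasDerivAt_chart (mem_chart_source E (d t)) hmd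
    have hself : chartDeriv E (d t) (d t) (mfderiv 𝓘(ℝ, ℝ) 𝓘(ℝ, E) d t (1 : ℝ)) =
      mfderiv 𝓘(ℝ, ℝ) 𝓘(ℝ, E) d t (1 : ℝ) := chartDeriv_self _ _
    rw [hself] at hp
    -- The tangent vector is nonzero because `l` advances at rate `Δ`; it pairs nonnegatively with
    -- each dual functional because these increase along `d`.
    refine g.futureCausal_of_forall_dual (fun h0 ↦ hΔ ?_) fun m hmp ↦ ?_
    · have h1 : HasDerivAt (fun s ↦ l (extChartAt 𝓘(ℝ, E) x (d s)))
          (l (chartDeriv E x (d t) (mfderiv 𝓘(ℝ, ℝ) 𝓘(ℝ, E) d t (1 : ℝ)))) t :=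
        l.hasFDerivAt.comp_hasDerivAt t hx
      have h2 : HasDerivAt (fun s ↦ l (extChartAt 𝓘(ℝ, E) x (d s))) Δ t := by
        have h3 : HasDerivAt (fun s : ℝ ↦ A + s * Δ) Δ t := by
          simpa using ((hasDerivAt_id t).mul_const Δ).const_add A
        exact h3.congr_of_eventuallyEq (eventually_of_mem hnhds hA)
      rw [h2.unique h1]
      have h4 : chartDeriv E x (d t) (mfderiv 𝓘(ℝ, ℝ) 𝓘(ℝ, E) d t (1 : ℝ)) = 0 :=
        (congrArg (chartDeriv E x (d t)) h0).trans (map_zero _)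
      rw [h4, map_zero]
    · obtain ⟨u, hu, hmono⟩ := hm t htI m hmp
      have h1 : HasDerivAt (fun s ↦ m (extChartAt 𝓘(ℝ, E) (d t) (d s)))
          (m (mfderiv 𝓘(ℝ, ℝ) 𝓘(ℝ, E) d t (1 : ℝ))) t := m.hasFDerivAt.comp_hasDerivAt t hp
      have h2 := hmono.derivWithin_nonneg (x := t)
      rwa [derivWithin_of_mem_nhds hu, h1.deriv] at h2

end Limits

end TimeOrientedLorentzMetric

namespace TimeOrientedLorentzMetric

section Limits

variable {E : Type*} [NormedAddCommGroup E] [NormedSpace ℝ E]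
  {M : Type*} [TopologicalSpace M] [ChartedSpace E M] [IsManifold 𝓘(ℝ, E) ∞ M]
  {g : TimeOrientedLorentzMetric E M}

/-- Two points of `K` are equal or joined by a future directed causal curve inside `K`. -/
def CausalRel (g : TimeOrientedLorentzMetric E M) (K : Set M) (y z : M) : Prop :=
  y = z ∨ ∃ c : ℝ → M, g.IsCausalOn c (Icc 0 1) ∧ c 0 = y ∧ c 1 = z ∧ MapsTo c (Icc 0 1) K

/-- A single ultrafilter provides limits at all parameters at once, replacing subsequences and
diagonal arguments. -/
theorem exists_ultrafilter_limit {ι X : Type*} [TopologicalSpace X] {K : Set X} (hK : IsCompact K)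
    (U : Ultrafilter ι) {u : ι → X} (hu : ∀ᶠ k in U, u k ∈ K) :
    ∃ x ∈ K, Tendsto u U (𝓝 x) := by
  obtain ⟨x, hx, h⟩ := hK.ultrafilter_le_nhds' (U.map u) hu
  exact ⟨x, hx, h⟩

omit [IsManifold 𝓘(ℝ, E) ∞ M] in
theorem tendsto_extChartAt {ι : Type*} {U : Filter ι} {x y : M} {u : ι → M}
    (hy : y ∈ (chartAt E x).source) (hu : Tendsto u U (𝓝 y)) :
    Tendsto (fun k ↦ extChartAt 𝓘(ℝ, E) x (u k)) U (𝓝 (extChartAt 𝓘(ℝ, E) x y)) :=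
  (continuousAt_extChartAt' (by rwa [extChartAt_source])).tendsto.comp hu

/-- A causal curve in a causal box, reparametrized proportionally to the functional of the box. -/
theorem IsCausalBox.exists_reparam {x : M} {l : E →L[ℝ] ℝ} {κ δ R : ℝ}
    (hB : g.IsCausalBox x l κ δ R) {c : ℝ → M} (hc : g.IsCausalOn c (Icc 0 1))
    (hK : MapsTo c (Icc 0 1) (chartClosedBall E x R)) :
    ∃ r : ℝ → ℝ, MonotoneOn r (Icc 0 1) ∧ MapsTo r (Icc 0 1) (Icc 0 1) ∧ r 0 = 0 ∧ r 1 = 1 ∧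
      ∀ s ∈ Icc (0 : ℝ) 1, l (extChartAt 𝓘(ℝ, E) x (c (r s))) =
        l (extChartAt 𝓘(ℝ, E) x (c 0)) +
          s * (l (extChartAt 𝓘(ℝ, E) x (c 1)) - l (extChartAt 𝓘(ℝ, E) x (c 0))) := by
  set f : ℝ → ℝ := fun t ↦ l (extChartAt 𝓘(ℝ, E) x (c t)) with hf
  have hmap : MapsTo c (Icc 0 1) (chartAt E x).source := fun t ht ↦ (hK ht).1
  have hcont : ContinuousOn f (Icc 0 1) := (hc.locallyLipschitzOn_dual hmap l).continuousOn
  have hmono : StrictMonoOn f (Icc 0 1) :=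
    hc.strictMonoOn_dual hmap l fun t ht v hv ↦ hB.dual_pos_strict (hK ht) hv
  have h0 : (0 : ℝ) ∈ Icc (0 : ℝ) 1 := by simp
  have h1 : (1 : ℝ) ∈ Icc (0 : ℝ) 1 := by simp
  have hlt : f 0 < f 1 := hmono h0 h1 one_pos
  have key : ∀ s : ℝ, ∃ r, s ∈ Icc (0 : ℝ) 1 → r ∈ Icc (0 : ℝ) 1 ∧ f r = f 0 + s * (f 1 - f 0) := by
    intro s
    by_cases hs : s ∈ Icc (0 : ℝ) 1
    · have : f 0 + s * (f 1 - f 0) ∈ Icc (f 0) (f 1) := by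
        constructor <;> nlinarith [hs.1, hs.2]
      obtain ⟨r, hr, hr'⟩ := intermediate_value_Icc zero_le_one hcont this
      exact ⟨r, fun _ ↦ ⟨hr, hr'⟩⟩
    · exact ⟨0, fun h ↦ absurd h hs⟩
  choose r hr using key
  refine ⟨r, fun s hs t ht hst ↦ ?_, fun s hs ↦ (hr s hs).1, ?_, ?_, fun s hs ↦ (hr s hs).2⟩
  · rw [← hmono.le_iff_le (hr s hs).1 (hr t ht).1, (hr s hs).2, (hr t ht).2]
    nlinarith
  · exact hmono.injOn (hr 0 h0).1 h0 (by rw [(hr 0 h0).2]; ring)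
  · exact hmono.injOn (hr 1 h1).1 h1 (by rw [(hr 1 h1).2]; ring)

/-- The causal relation of a causal box passes to limits. -/
theorem IsCausalBox.causalRel_of_tendsto [FiniteDimensional ℝ E] [T2Space M] {x : M}
    {l : E →L[ℝ] ℝ} {κ δ R : ℝ} (hB : g.IsCausalBox x l κ δ R) {ι : Type*} (U : Ultrafilter ι)
    {u w : ι → M} {y z : M} (hu : Tendsto u U (𝓝 y)) (hw : Tendsto w U (𝓝 z))
    (h : ∀ᶠ k in U, u k ∈ chartClosedBall E x R ∧
      g.CausalRel (chartClosedBall E x R) (u k) (w k)) :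
    g.CausalRel univ y z := by
  set K := chartClosedBall E x R with hKdef
  have hKc : IsCompact K := isCompact_chartClosedBall hB.subset_target
  by_cases hyz : y = z
  · exact Or.inl hyz
  have hcurve : ∀ᶠ k in U, ∃ c : ℝ → M, g.IsCausalOn c (Icc 0 1) ∧ c 0 = u k ∧ c 1 = w k ∧
      MapsTo c (Icc 0 1) K := by
    -- If the set of indices with a curve is not in the ultrafilter, its complement is, and there `u
    -- k = w k`, against `y ≠ z`.
    by_contra hn
    rw [← Ultrafilter.eventually_not] at hn
    refine hyz (tendsto_nhds_unique_of_eventuallyEq hu hw ?_)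
    filter_upwards [h, hn] with k hk hnk using hk.2.resolve_right hnk
  have hchoice : ∀ k, ∃ c : ℝ → M, ∃ r : ℝ → ℝ, (∃ c : ℝ → M, g.IsCausalOn c (Icc 0 1) ∧
      c 0 = u k ∧ c 1 = w k ∧ MapsTo c (Icc 0 1) K) → g.IsCausalOn c (Icc 0 1) ∧ c 0 = u k ∧
      c 1 = w k ∧ MapsTo c (Icc 0 1) K ∧ MonotoneOn r (Icc 0 1) ∧
      MapsTo r (Icc 0 1) (Icc 0 1) ∧ r 0 = 0 ∧ r 1 = 1 ∧
      ∀ s ∈ Icc (0 : ℝ) 1, l (extChartAt 𝓘(ℝ, E) x (c (r s))) =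
        l (extChartAt 𝓘(ℝ, E) x (c 0)) +
          s * (l (extChartAt 𝓘(ℝ, E) x (c 1)) - l (extChartAt 𝓘(ℝ, E) x (c 0))) := by
    intro k
    by_cases hk : ∃ c : ℝ → M, g.IsCausalOn c (Icc 0 1) ∧ c 0 = u k ∧ c 1 = w k ∧
      MapsTo c (Icc 0 1) K
    · obtain ⟨c, hc, h0, h1, hK⟩ := hk
      obtain ⟨r, hr⟩ := hB.exists_reparam hc hK
      exact ⟨c, r, fun _ ↦ ⟨hc, h0, h1, hK, hr⟩⟩
    · exact ⟨fun _ ↦ y, fun _ ↦ 0, fun h ↦ absurd h hk⟩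
  choose c r hcr using hchoice
  have H := hcurve.mono fun k hk ↦ hcr k hk
  clear hcr hcurve h
  set φ := extChartAt 𝓘(ℝ, E) x with hφ
  have hd : ∀ s : ℝ, ∃ p, s ∈ Icc (0 : ℝ) 1 → p ∈ K ∧ Tendsto (fun k ↦ c k (r k s)) U (𝓝 p) := by
    intro s
    by_cases hs : s ∈ Icc (0 : ℝ) 1
    · obtain ⟨p, hp, hp'⟩ := exists_ultrafilter_limit hKc U (u := fun k ↦ c k (r k s))
        (H.mono fun k hk ↦ hk.2.2.2.1 (hk.2.2.2.2.2.1 hs))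
      exact ⟨p, fun _ ↦ ⟨hp, hp'⟩⟩
    · exact ⟨y, fun h ↦ absurd h hs⟩
  choose d hd using hd
  have m0 : (0 : ℝ) ∈ Icc (0 : ℝ) 1 := by simp
  have m1 : (1 : ℝ) ∈ Icc (0 : ℝ) 1 := by simp
  have hd0 : d 0 = y := by
    refine tendsto_nhds_unique_of_eventuallyEq (hd 0 m0).2 hu (H.mono fun k hk ↦ ?_)
    obtain ⟨-, h0, -, -, -, -, hr0, -⟩ := hk
    simp only [hr0, h0]
  have hd1 : d 1 = z := by
    refine tendsto_nhds_unique_of_eventuallyEq (hd 1 m1).2 hw (H.mono fun k hk ↦ ?_)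
    obtain ⟨-, -, h1, -, -, -, -, hr1, -⟩ := hk
    simp only [hr1, h1]
  have hys : y ∈ (chartAt E x).source := by rw [← hd0]; exact (hd 0 m0).1.1
  have hzs : z ∈ (chartAt E x).source := by rw [← hd1]; exact (hd 1 m1).1.1
  have hφd (s : ℝ) (hs : s ∈ Icc (0 : ℝ) 1) :
      Tendsto (fun k ↦ φ (c k (r k s))) U (𝓝 (φ (d s))) :=
    tendsto_extChartAt (hd s hs).1.1 (hd s hs).2
  have hφu : Tendsto (fun k ↦ φ (u k)) U (𝓝 (φ y)) := tendsto_extChartAt hys hu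
  have hφw : Tendsto (fun k ↦ φ (w k)) U (𝓝 (φ z)) := tendsto_extChartAt hzs hw
  have hlu : Tendsto (fun k ↦ l (φ (u k))) U (𝓝 (l (φ y))) := (l.continuous.tendsto _).comp hφu
  have hlw : Tendsto (fun k ↦ l (φ (w k))) U (𝓝 (l (φ z))) := (l.continuous.tendsto _).comp hφw
  set Δ := l (φ z) - l (φ y) with hΔ
  have hlΔ : Tendsto (fun k ↦ l (φ (w k)) - l (φ (u k))) U (𝓝 Δ) := hlw.sub hlu
  have hA : ∀ s ∈ Icc (0 : ℝ) 1, l (φ (d s)) = l (φ y) + s * Δ := by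
    intro s hs
    refine tendsto_nhds_unique_of_eventuallyEq ((l.continuous.tendsto _).comp (hφd s hs))
      (hlu.add (hlΔ.const_mul s)) (H.mono fun k hk ↦ ?_)
    obtain ⟨-, h0, h1, -, -, -, -, -, hk⟩ := hk
    simp only [Function.comp_apply]
    rw [hk s hs, h0, h1]
  -- The reparametrization makes the curves uniformly Lipschitz. The bound covers every `q` between
  -- `r k s` and `r k t`, so that it controls whole segments and not only their endpoints.
  have hest : ∀ᶠ k in U, ∀ s ∈ Icc (0 : ℝ) 1, ∀ t ∈ Icc (0 : ℝ) 1, s ≤ t →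
      ∀ q ∈ Icc (r k s) (r k t), κ * ‖φ (c k q) - φ (c k (r k s))‖ ≤
        (t - s) * (l (φ (w k)) - l (φ (u k))) := by
    filter_upwards [H] with k hk s hs t ht hst q hq
    obtain ⟨hc, h0, h1, hK, hrm, hrI, -, -, hk⟩ := hk
    have hmap : MapsTo (c k) (Icc 0 1) (chartAt E x).source := fun t ht ↦ (hK ht).1
    have hqI : q ∈ Icc (0 : ℝ) 1 := ⟨(hrI hs).1.trans hq.1, hq.2.trans (hrI ht).2⟩
    have e1 := hc.norm_sub_le_dual hmap l hB.κ_pos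
      (fun t ht v hv ↦ hB.dual_pos _ (hK ht) v hv) (hrI hs) hqI hq.1
    have e2 := (hc.strictMonoOn_dual hmap l
      fun t ht v hv ↦ hB.dual_pos_strict (hK ht) hv).monotoneOn hqI (hrI ht) hq.2
    have e3 := hk s hs
    have e4 := hk t ht
    rw [h0, h1] at e3 e4
    calc _ ≤ _ := e1
      _ ≤ l (φ (c k (r k t))) - l (φ (c k (r k s))) := sub_le_sub_right e2 _
      _ = _ := by rw [e3, e4]; ring
  have hrmono : ∀ᶠ k in U, ∀ s ∈ Icc (0 : ℝ) 1, ∀ t ∈ Icc (0 : ℝ) 1, s ≤ t → r k s ≤ r k t :=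
    H.mono fun k hk s hs t ht hst ↦ hk.2.2.2.2.1 hs ht hst
  have hlim : ∀ s ∈ Icc (0 : ℝ) 1, ∀ t ∈ Icc (0 : ℝ) 1, s ≤ t →
      κ * ‖φ (d t) - φ (d s)‖ ≤ (t - s) * Δ := by
    intro s hs t ht hst
    refine le_of_tendsto_of_tendsto (((hφd t ht).sub (hφd s hs)).norm.const_mul κ)
      (hlΔ.const_mul (t - s)) ?_
    filter_upwards [hest, hrmono] with k hk hrk
    exact hk s hs t ht hst _ ⟨hrk s hs t ht hst, le_rfl⟩
  have hκ := hB.κ_pos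
  have hΔpos : 0 < Δ := by
    have h1 := hlim 0 m0 1 m1 zero_le_one
    rw [hd0, hd1, sub_zero, one_mul] at h1
    refine lt_of_lt_of_le (mul_pos hκ (norm_pos_iff.2 (sub_ne_zero.2 fun h ↦ hyz ?_))) h1
    exact ((extChartAt 𝓘(ℝ, E) x).injOn (by rwa [extChartAt_source])
      (by rwa [extChartAt_source]) h).symm
  have hlim' : ∀ s ∈ Icc (0 : ℝ) 1, ∀ t ∈ Icc (0 : ℝ) 1,
      ‖φ (d t) - φ (d s)‖ ≤ Δ / κ * |t - s| := by
    intro s hs t ht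
    rw [div_mul_eq_mul_div, le_div_iff₀ hκ, mul_comm]
    rcases le_total s t with hst | hst
    · rw [abs_of_nonneg (by linarith), mul_comm Δ]; exact hlim s hs t ht hst
    · rw [abs_of_nonpos (by linarith), norm_sub_rev, mul_comm Δ, neg_sub]
      exact hlim t ht s hs hst
  refine Or.inr ⟨d, ?_, hd0, hd1, mapsTo_univ _ _⟩
  have hLip : LipschitzOnWith (Real.toNNReal (Δ / κ)) (fun s ↦ φ (d s)) (Icc 0 1) :=
    LipschitzOnWith.of_dist_le_mul fun t ht s hs ↦ by
      rw [dist_eq_norm, Real.dist_eq, Real.coe_toNNReal _ (by positivity)]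
      exact hlim' s hs t ht
  refine isCausalOn_of_monotone_dual (fun s hs ↦ (hd s hs).1.1) hLip l hΔpos.ne' hA ?_
  intro t ht m hm
  have htI := Ioo_subset_Icc_self ht
  obtain ⟨κ', hκ', hN⟩ := g.eventually_dual_pos (d t) m hm
  obtain ⟨ρ, hρ, hball⟩ := exists_pos_of_mem_nhds (hd t htI).1.1
    (inter_mem hN ((chartAt E (d t)).open_source.mem_nhds (mem_chart_source E (d t))))
  -- The limit curve, of Lipschitz constant `Δ / κ`, moves at most `ρ / 8` in time `ε`, and
  -- approximating segments between two such parameters eventually move less than `ρ / 2`. They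
  -- therefore stay in the `ρ`-ball, where `m` is positive on the cones.
  set ε := κ * ρ / (8 * Δ) with hε
  have hεpos : 0 < ε := by positivity
  have hεΔ : Δ / κ * ε = ρ / 8 := by rw [hε]; field_simp
  refine ⟨Icc 0 1 ∩ Metric.ball t ε,
    inter_mem (Icc_mem_nhds ht.1 ht.2) (Metric.ball_mem_nhds t hεpos), ?_⟩
  rintro s ⟨hsI, hs⟩ s' ⟨hsI', hs'⟩ hss
  rw [Metric.mem_ball, Real.dist_eq] at hs hs'
  have near : ∀ s ∈ Icc (0 : ℝ) 1, |s - t| < ε → ‖φ (d s) - φ (d t)‖ < ρ / 4 := by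
    intro s hsI hs
    calc _ ≤ Δ / κ * |s - t| := hlim' t htI s hsI
      _ ≤ Δ / κ * ε := by gcongr
      _ < ρ / 4 := by rw [hεΔ]; linarith
  have hsrc : ∀ s ∈ Icc (0 : ℝ) 1, |s - t| < ε → d s ∈ (chartAt E (d t)).source := fun s hsI hs ↦
    (hball _ (hd s hsI).1.1 ((near s hsI hs).trans (by linarith))).2
  have hmt : ∀ s ∈ Icc (0 : ℝ) 1, |s - t| < ε →
      Tendsto (fun k ↦ m (extChartAt 𝓘(ℝ, E) (d t) (c k (r k s)))) U
        (𝓝 (m (extChartAt 𝓘(ℝ, E) (d t) (d s)))) := fun s hsI hs ↦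
    (m.continuous.tendsto _).comp (tendsto_extChartAt (hsrc s hsI hs) (hd s hsI).2)
  refine le_of_tendsto_of_tendsto (hmt s hsI hs) (hmt s' hsI' hs') ?_
  have e1 : ∀ᶠ k in U, ‖φ (c k (r k s)) - φ (d t)‖ < ρ / 4 :=
    ((hφd s hsI).sub_const (φ (d t))).norm.eventually (gt_mem_nhds (near s hsI hs))
  have e2 : ∀ᶠ k in U, (s' - s) * (l (φ (w k)) - l (φ (u k))) < κ * (ρ / 2) := by
    refine (hlΔ.const_mul (s' - s)).eventually (gt_mem_nhds ?_)
    have h1 : s' - s < 2 * ε := by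
      have := abs_lt.1 hs; have := abs_lt.1 hs'; linarith
    calc (s' - s) * Δ ≤ 2 * ε * Δ := by gcongr
      _ = κ * (ρ / 4) := by rw [hε]; field_simp; ring
      _ < κ * (ρ / 2) := by gcongr; linarith
  filter_upwards [H, hest, hrmono, e1, e2] with k hk hest hrm e1 e2
  obtain ⟨hc, -, -, hK, -, hrI, -⟩ := hk
  have hle := hrm s hsI s' hsI' hss
  have hsub : Icc (r k s) (r k s') ⊆ Icc 0 1 := Icc_subset_Icc (hrI hsI).1 (hrI hsI').2
  have hin : ∀ q ∈ Icc (r k s) (r k s'), c k q ∈ {y | ∀ v : TangentSpace 𝓘(ℝ, E) y,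
      g.FutureCausal y v → κ' * ‖chartDeriv E (d t) y v‖ ≤ m (chartDeriv E (d t) y v)} ∩
      (chartAt E (d t)).source := by
    intro q hq
    refine hball _ (hK (hsub hq)).1 ?_
    have h1 := (hest s hsI s' hsI' hss q hq).trans_lt e2
    have h2 : ‖φ (c k q) - φ (c k (r k s))‖ < ρ / 2 := lt_of_mul_lt_mul_left h1 hκ.le
    calc _ = ‖(φ (c k q) - φ (c k (r k s))) + (φ (c k (r k s)) - φ (d t))‖ := by
          rw [sub_add_sub_cancel]
      _ ≤ _ := norm_add_le _ _
      _ < ρ := by linarith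
  exact (hc.mono hsub).monotoneOn_dual (fun q hq ↦ (hin q hq).2) m
    (fun q hq v hv ↦ (mul_nonneg hκ'.le (norm_nonneg _)).trans ((hin q hq).1 v hv))
    ⟨le_rfl, hle⟩ ⟨hle, le_rfl⟩ hle

end Limits

end TimeOrientedLorentzMetric

namespace TimeOrientedLorentzMetric

/-! ### Time reversal, which transfers statements about the future to the past. -/

section Reverse

variable {E : Type*} [NormedAddCommGroup E] [NormedSpace ℝ E]
  {M : Type*} [TopologicalSpace M] [ChartedSpace E M] [IsManifold 𝓘(ℝ, E) ∞ M]

/-- The same metric with the opposite time orientation. -/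
noncomputable def reverse (g : TimeOrientedLorentzMetric E M) : TimeOrientedLorentzMetric E M where
  metric := g.metric
  symm := g.symm
  lorentzian := g.lorentzian
  contMDiff_metric := g.contMDiff_metric
  timeField x := -g.timeField x
  timeField_timelike x := by simpa using g.timeField_timelike x
  contMDiff_timeField := by
    have := isManifold_one (E := E) (M := M)
    exact g.contMDiff_timeField.neg_section

variable {g : TimeOrientedLorentzMetric E M}

theorem reverse_reverse : g.reverse.reverse = g := by
  cases g
  simp [reverse]

theorem FutureCausal.neg_reverse {x : M} {v : TangentSpace 𝓘(ℝ, E) x} (h : g.FutureCausal x v) :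
    g.reverse.FutureCausal x ((-1 : ℝ) • v) := by
  refine ⟨?_, ?_⟩
  · change g.metric x ((-1 : ℝ) • v) ((-1 : ℝ) • v) ≤ 0
    simpa using h.1
  · change g.metric x (-g.timeField x) ((-1 : ℝ) • v) < 0
    simpa using h.2

theorem IsCausalOn.reverse {c : ℝ → M} {I : Set ℝ} (h : g.IsCausalOn c I) (β : ℝ) :
    g.reverse.IsCausalOn (fun t ↦ c (-1 * t + β)) ((fun t ↦ -1 * t + β) ⁻¹' I) :=
  h.comp_affine_of_forall (by norm_num) β fun _ _ hv ↦ hv.neg_reverse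

/-- The tangent condition concerns only the interior of the interval, which is empty here. -/
theorem isCausalOn_singleton (c : ℝ → M) (a : ℝ) : g.IsCausalOn c {a} where
  continuousOn := continuousOn_singleton _ _
  locallyLipschitz _ _ := ⟨0, {a}, self_mem_nhdsWithin, by
    rintro x rfl y rfl
    simp⟩
  futureCausal := by simp

end Reverse

/-! ### The causal relation: concatenation and straight causal segments. -/

section CausalRel

variable {E : Type*} [NormedAddCommGroup E] [NormedSpace ℝ E]
  {M : Type*} [TopologicalSpace M] [ChartedSpace E M] [IsManifold 𝓘(ℝ, E) ∞ M]
  {g : TimeOrientedLorentzMetric E M} {K : Set M} {x y z : M}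

theorem IsCausalOn.causalRel {c : ℝ → M} {a b : ℝ} (h : g.IsCausalOn c (Icc a b)) (hab : a ≤ b)
    (hK : MapsTo c (Icc a b) K) : g.CausalRel K (c a) (c b) := by
  rcases hab.eq_or_lt with rfl | hab
  · exact Or.inl rfl
  · have hmaps : Icc (0 : ℝ) 1 ⊆ (fun t ↦ (b - a) * t + a) ⁻¹' Icc a b := by
      intro t ht
      constructor <;> nlinarith [ht.1, ht.2]
    refine Or.inr ⟨fun t ↦ c ((b - a) * t + a),
      (h.comp_affine (sub_pos.2 hab) a).mono hmaps, by simp, by simp, fun t ht ↦ hK (hmaps ht)⟩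

theorem IsCausalOn.causalRel_univ {c : ℝ → M} {I : Set ℝ} [hI : I.OrdConnected]
    (h : g.IsCausalOn c I) {a b : ℝ} (ha : a ∈ I) (hb : b ∈ I) (hab : a ≤ b) :
    g.CausalRel univ (c a) (c b) :=
  (h.mono (hI.out ha hb)).causalRel hab (mapsTo_univ _ _)

theorem CausalRel.refl (g : TimeOrientedLorentzMetric E M) (x : M) : g.CausalRel K x x := Or.inl rfl

theorem CausalRel.mono (h : g.CausalRel K x y) {L : Set M} (hKL : K ⊆ L) : g.CausalRel L x y :=
  h.imp_right fun ⟨c, h1, h2, h3, h4⟩ ↦ ⟨c, h1, h2, h3, h4.mono_right hKL⟩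

/-- Concatenation of two causal curves. -/
theorem exists_isCausalOn_concat {c₁ c₂ : ℝ → M} {a b d : ℝ} (h₁ : g.IsCausalOn c₁ (Icc a b))
    (h₂ : g.IsCausalOn c₂ (Icc b d)) (hab : a ≤ b) (hbd : b ≤ d) (h : c₁ b = c₂ b) :
    ∃ c, g.IsCausalOn c (Icc a d) ∧ EqOn c c₁ (Icc a b) ∧ EqOn c c₂ (Icc b d) := by
  have e1 : EqOn (fun t ↦ if t ≤ b then c₁ t else c₂ t) c₁ (Icc a b) := fun t ht ↦ by
    simp [ht.2]
  have e2 : EqOn (fun t ↦ if t ≤ b then c₁ t else c₂ t) c₂ (Icc b d) := fun t ht ↦ by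
    rcases ht.1.eq_or_lt with rfl | hlt
    · simp [h]
    · simp [hlt.not_ge]
  refine ⟨_, ?_, e1, e2⟩
  rw [← Icc_union_Icc_eq_Icc hab hbd]
  exact (h₁.congr e1).union (h₂.congr e2) Icc_subset_Iic_self Icc_subset_Ici_self
    (right_mem_Icc.2 hab) (left_mem_Icc.2 hbd)

theorem IsCausalOn.shift {c : ℝ → M} {a b : ℝ} (h : g.IsCausalOn c (Icc a b)) (s : ℝ) :
    g.IsCausalOn (fun t ↦ c (t - s)) (Icc (a + s) (b + s)) := by
  have := (h.comp_affine one_pos (-s)).mono (J := Icc (a + s) (b + s)) fun t ht ↦ by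
    constructor <;> linarith [ht.1, ht.2]
  refine this.congr fun t _ ↦ ?_
  simp [sub_eq_add_neg]

theorem CausalRel.trans (h₁ : g.CausalRel K x y) (h₂ : g.CausalRel K y z) :
    g.CausalRel K x z := by
  rcases h₁ with rfl | ⟨c₁, hc₁, rfl, rfl, hK₁⟩
  · exact h₂
  rcases h₂ with rfl | ⟨c₂, hc₂, h, rfl, hK₂⟩
  · exact Or.inr ⟨c₁, hc₁, rfl, rfl, hK₁⟩
  have hs := hc₂.shift 1
  norm_num at hs
  obtain ⟨c, hc, e1, e2⟩ := exists_isCausalOn_concat hc₁ hs zero_le_one one_le_two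
    (by simpa using h.symm)
  have h0 : c 0 = c₁ 0 := e1 (by simp)
  have h2 : c 2 = c₂ 1 := by rw [e2 (by simp : (2 : ℝ) ∈ Icc (1 : ℝ) 2)]; norm_num
  rw [← h0, ← h2]
  refine hc.causalRel zero_le_two fun t ht ↦ ?_
  rcases le_total t 1 with h | h
  · rw [e1 ⟨ht.1, h⟩]; exact hK₁ ⟨ht.1, h⟩
  · rw [e2 ⟨h, ht.2⟩]; exact hK₂ ⟨by linarith, by linarith [ht.2]⟩

theorem CausalRel.reverse (h : g.CausalRel K x y) : g.reverse.CausalRel K y x := by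
  rcases h with rfl | ⟨c, hc, rfl, rfl, hK⟩
  · exact Or.inl rfl
  · have hmaps : Icc (0 : ℝ) 1 ⊆ (fun t ↦ -1 * t + 1) ⁻¹' Icc 0 1 := by
      intro t ht
      constructor <;> linarith [ht.1, ht.2]
    exact Or.inr ⟨fun t ↦ c (-1 * t + 1), (hc.reverse 1).mono hmaps, by simp, by simp,
      fun t ht ↦ hK (hmaps ht)⟩

theorem causalRel_reverse_iff : g.reverse.CausalRel K y x ↔ g.CausalRel K x y :=
  ⟨fun h ↦ by simpa only [reverse_reverse] using h.reverse, fun h ↦ h.reverse⟩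

/-- In a causal box, straight lines in directions close to the time orientation are causal. -/
theorem IsCausalBox.causalRel_of_near {x₀ : M} {l : E →L[ℝ] ℝ} {κ δ R : ℝ}
    (hB : g.IsCausalBox x₀ l κ δ R) (hy : y ∈ chartClosedBall E x₀ R)
    (hz : z ∈ chartClosedBall E x₀ R) {t : ℝ} (ht : 0 < t)
    (h : ‖extChartAt 𝓘(ℝ, E) x₀ z - extChartAt 𝓘(ℝ, E) x₀ y - t • g.timeVector x₀‖ < t * δ) :
    g.CausalRel (chartClosedBall E x₀ R) y z := by
  set φ := extChartAt 𝓘(ℝ, E) x₀ with hφ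
  set u := φ z - φ y with hu
  set c : ℝ → M := fun s ↦ φ.symm (φ y + s • u) with hc
  have hball : ∀ s ∈ Icc (0 : ℝ) 1, φ y + s • u ∈ Metric.closedBall (φ x₀) R := by
    intro s hs
    have h1 := (convex_closedBall (φ x₀) R).add_smul_sub_mem hy.2 hz.2 hs
    exact h1
  have htar : ∀ s ∈ Icc (0 : ℝ) 1, φ y + s • u ∈ φ.target := fun s hs ↦
    hB.subset_target (hball s hs)
  have hφc : ∀ s ∈ Icc (0 : ℝ) 1, φ (c s) = φ y + s • u := fun s hs ↦ φ.right_inv (htar s hs)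
  have hsrc : ∀ s ∈ Icc (0 : ℝ) 1, c s ∈ (chartAt E x₀).source := fun s hs ↦ by
    rw [← extChartAt_source 𝓘(ℝ, E)]; exact φ.map_target (htar s hs)
  have hK : MapsTo c (Icc 0 1) (chartClosedBall E x₀ R) := fun s hs ↦
    ⟨hsrc s hs, by rw [mem_preimage, ← hφ, hφc s hs]; exact hball s hs⟩
  have hcont : ContinuousOn c (Icc 0 1) :=
    (continuousOn_extChartAt_symm x₀).comp (by fun_prop) htar
  have hLip : LipschitzOnWith ‖u‖₊ (fun s ↦ φ (c s)) (Icc 0 1) :=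
    LipschitzOnWith.of_dist_le_mul fun s hs s' hs' ↦ by
      rw [hφc s hs, hφc s' hs', dist_add_left, dist_eq_norm, ← sub_smul, norm_smul, mul_comm,
        dist_eq_norm, coe_nnnorm]
  have hcausal : g.IsCausalOn c (Icc 0 1) := by
    refine ⟨hcont, fun s hs ↦ ?_, Eventually.of_forall fun s hs ↦ ?_⟩
    · exact exists_lipschitzOnWith_comp (f := extChartAt 𝓘(ℝ, E) (c s)) (hcont s hs) (hsrc s hs)
        ⟨_, Icc 0 1, self_mem_nhdsWithin, hLip⟩ (contMDiffAt_extChartAt_one (mem_chart_source E _))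
    · rw [interior_Icc] at hs
      have hnhds : Icc (0 : ℝ) 1 ∈ 𝓝 s := Icc_mem_nhds hs.1 hs.2
      have hsI := Ioo_subset_Icc_self hs
      have hd : HasDerivAt (fun s ↦ φ (c s)) u s := by
        have h1 : HasDerivAt (fun s : ℝ ↦ φ y + s • u) u s := by
          simpa using ((hasDerivAt_id s).smul_const u).const_add (φ y)
        exact h1.congr_of_eventuallyEq (eventually_of_mem hnhds hφc)
      have hmd := mdifferentiableAt_of_chart (eventually_of_mem hnhds hsrc) hd.differentiableAt
      have he := hd.unique (hasDerivAt_chart (hsrc s hsI) hmd)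
      set v := mfderiv 𝓘(ℝ, ℝ) 𝓘(ℝ, E) c s (1 : ℝ) with hv
      -- The constant velocity `u` is within `t * δ` of `t` times the time vector; dividing by `t`
      -- brings it into the `δ`-ball that lies in the cones.
      have hsm : g.FutureCausal (c s) (t⁻¹ • v) := by
        refine hB.futureCausal _ (hK hsI) _ ?_
        have h1 : chartDeriv E x₀ (c s) (t⁻¹ • v) = t⁻¹ • u := by
          rw [he]; exact map_smul _ _ _
        rw [h1, show t⁻¹ • u - g.timeVector x₀ = t⁻¹ • (u - t • g.timeVector x₀) by
          rw [smul_sub t⁻¹ u, inv_smul_smul₀ ht.ne'], norm_smul, norm_inv, Real.norm_of_nonneg ht.le,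
          inv_mul_lt_iff₀ ht]
        exact h
      have := hsm.smul ht
      rwa [smul_inv_smul₀ ht.ne'] at this
  refine Or.inr ⟨c, hcausal, ?_, ?_, hK⟩
  · simp only [hc, zero_smul, add_zero]
    exact φ.left_inv (by rw [hφ, extChartAt_source]; exact hy.1)
  · simp only [hc, one_smul, hu, add_sub_cancel]
    exact φ.left_inv (by rw [hφ, extChartAt_source]; exact hz.1)

theorem timeVector_ne_zero (g : TimeOrientedLorentzMetric E M) (x : M) : g.timeVector x ≠ 0 := by
  intro h
  have h1 := g.timeField_timelike x
  have h2 : g.timeField x = 0 := h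
  simp [h2] at h1

omit [IsManifold 𝓘(ℝ, E) ∞ M] in
/-- Points of a chart with prescribed coordinates. -/
theorem exists_mem_chart {x₀ : M} {R : ℝ}
    (h : Metric.closedBall (extChartAt 𝓘(ℝ, E) x₀ x₀) R ⊆ (extChartAt 𝓘(ℝ, E) x₀).target) {w : E}
    (hw : ‖w - extChartAt 𝓘(ℝ, E) x₀ x₀‖ ≤ R) :
    ∃ y ∈ chartClosedBall E x₀ R, extChartAt 𝓘(ℝ, E) x₀ y = w := by
  have hw' : w ∈ Metric.closedBall (extChartAt 𝓘(ℝ, E) x₀ x₀) R := mem_closedBall_iff_norm.2 hw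
  have he := (extChartAt 𝓘(ℝ, E) x₀).right_inv (h hw')
  refine ⟨(extChartAt 𝓘(ℝ, E) x₀).symm w, ⟨?_, ?_⟩, he⟩
  · rw [← extChartAt_source 𝓘(ℝ, E)]; exact (extChartAt 𝓘(ℝ, E) x₀).map_target (h hw')
  · rw [mem_preimage, he]; exact hw'

variable [FiniteDimensional ℝ E]

/-- Every neighbourhood of `x` contains a nonempty open set in the causal future of `x`. -/
theorem exists_open_subset_future (g : TimeOrientedLorentzMetric E M) (x : M) {W : Set M}
    (hW : W ∈ 𝓝 x) : ∃ O ⊆ W, IsOpen O ∧ O.Nonempty ∧ ∀ y ∈ O, g.CausalRel univ x y := by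
  obtain ⟨l, κ, δ, R, hB, hBW⟩ := g.exists_isCausalBox x hW
  have hδ := hB.δ_pos
  have hR := hB.R_pos
  set φ := extChartAt 𝓘(ℝ, E) x with hφ
  set X := g.timeVector x with hX
  have hden : 0 < ‖X‖ + δ := by positivity
  -- The largest `t` for which the ball of radius `t * δ` around `φ x + t • X` fits into the box.
  set t := R / (‖X‖ + δ) with ht
  have htp : 0 < t := by positivity
  have htR : t * ‖X‖ + t * δ = R := by rw [ht]; field_simp
  have hO : IsOpen ((chartAt E x).source ∩ φ ⁻¹' Metric.ball (φ x + t • X) (t * δ)) := by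
    have h := (continuousOn_extChartAt (I := 𝓘(ℝ, E)) x).isOpen_inter_preimage
      (isOpen_extChartAt_source x) (Metric.isOpen_ball (x := φ x + t • X) (ε := t * δ))
    rwa [extChartAt_source] at h
  have hsub : (chartAt E x).source ∩ φ ⁻¹' Metric.ball (φ x + t • X) (t * δ) ⊆
      chartClosedBall E x R := by
    rintro y ⟨hy, hyb⟩
    refine ⟨hy, mem_closedBall_iff_norm.2 ?_⟩
    have hyb' := mem_ball_iff_norm.1 hyb
    calc ‖φ y - φ x‖ = ‖(φ y - (φ x + t • X)) + t • X‖ := by congr 1; abel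
      _ ≤ ‖φ y - (φ x + t • X)‖ + ‖t • X‖ := norm_add_le _ _
      _ ≤ t * δ + t * ‖X‖ := by
        rw [norm_smul, Real.norm_of_nonneg htp.le]; gcongr
      _ = R := by linarith
  refine ⟨_, hsub.trans hBW, hO, ?_, fun y hy ↦ ?_⟩
  · obtain ⟨y, hy, hye⟩ := exists_mem_chart (w := φ x + t • X) hB.subset_target (by
      rw [add_sub_cancel_left, norm_smul, Real.norm_of_nonneg htp.le]
      have : 0 < t * δ := by positivity
      linarith)
    exact ⟨y, hy.1, by rw [mem_preimage, hye]; exact Metric.mem_ball_self (by positivity)⟩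
  · refine (hB.causalRel_of_near ⟨mem_chart_source E x, ?_⟩ (hsub hy) htp ?_).mono (subset_univ _)
    · exact Metric.mem_closedBall_self hR.le
    · have := mem_ball_iff_norm.1 hy.2
      rwa [← sub_sub] at this

/-- Near `x` there is a point which precedes `x` causally, along a curve near `x`, and whose causal
future is a neighbourhood of `x`. -/
theorem exists_past_mem_nhds (g : TimeOrientedLorentzMetric E M) (x : M) {W : Set M}
    (hW : W ∈ 𝓝 x) : ∃ y, g.CausalRel W y x ∧ {z | g.CausalRel univ y z} ∈ 𝓝 x := by
  obtain ⟨l, κ, δ, R, hB, hBW⟩ := g.exists_isCausalBox x hW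
  have hδ := hB.δ_pos
  have hR := hB.R_pos
  set φ := extChartAt 𝓘(ℝ, E) x with hφ
  set X := g.timeVector x with hX
  set t := R / (‖X‖ + δ) with ht
  have hden : 0 < ‖X‖ + δ := by positivity
  have htp : 0 < t := by positivity
  have htR : t * ‖X‖ + t * δ = R := by rw [ht]; field_simp
  have htδ : 0 < t * δ := by positivity
  have htX : 0 ≤ t * ‖X‖ := by positivity
  obtain ⟨y, hy, hye⟩ := exists_mem_chart (w := φ x - t • X) hB.subset_target (by
    rw [sub_sub_cancel_left, norm_neg, norm_smul, Real.norm_of_nonneg htp.le]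
    linarith)
  have key : ∀ z ∈ chartClosedBall E x R, ‖φ z - φ x‖ < t * δ →
      g.CausalRel (chartClosedBall E x R) y z := fun z hz hzx ↦ by
    refine hB.causalRel_of_near hy hz htp ?_
    rw [hye]
    rwa [show φ z - (φ x - t • X) - t • X = φ z - φ x by abel]
  have hxK : x ∈ chartClosedBall E x R :=
    ⟨mem_chart_source E x, Metric.mem_closedBall_self hR.le⟩
  refine ⟨y, (key x hxK (by simpa using htδ)).mono hBW, ?_⟩
  refine mem_of_superset ((isOpen_chartBall (E := E) x (t * δ)).mem_nhds (mem_chartBall_self x htδ)) ?_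
  intro z hz
  have hz' := mem_ball_iff_norm.1 hz.2
  exact (key z (chartClosedBall_mono x (by linarith) (chartBall_subset_chartClosedBall x _ hz))
    hz').mono (subset_univ _)

/-- Around each point there is a neighbourhood all of whose points can leave it to the future. -/
theorem exists_mem_nhds_exit (g : TimeOrientedLorentzMetric E M) (x : M) :
    ∃ N ∈ 𝓝 x, ∀ y ∈ N, ∃ z ∉ N, g.CausalRel univ y z := by
  obtain ⟨l, κ, δ, R, hB, -⟩ := g.exists_isCausalBox x univ_mem
  have hδ := hB.δ_pos
  have hR := hB.R_pos
  set φ := extChartAt 𝓘(ℝ, E) x with hφ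
  set X := g.timeVector x with hX
  have hXp : 0 < ‖X‖ := norm_pos_iff.2 (g.timeVector_ne_zero x)
  set r := R / 4 with hr
  have hrp : 0 < r := by positivity
  refine ⟨chartBall E x r, (isOpen_chartBall (E := E) x r).mem_nhds (mem_chartBall_self x hrp), ?_⟩
  intro y hy
  have hyb := mem_ball_iff_norm.1 hy.2
  -- A displacement of length `2 * r` leaves the `r`-ball from any of its points, yet stays in the
  -- box since `3 * r ≤ R`.
  set t := 2 * r / ‖X‖ with ht
  have htp : 0 < t := by positivity
  have htX : ‖t • X‖ = 2 * r := by
    rw [norm_smul, Real.norm_of_nonneg htp.le, ht]; field_simp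
  obtain ⟨z, hz, hze⟩ := exists_mem_chart (w := φ y + t • X) hB.subset_target (by
    calc _ = ‖(φ y - φ x) + t • X‖ := by congr 1; abel
      _ ≤ _ := norm_add_le _ _
      _ ≤ R := by rw [htX]; linarith)
  refine ⟨z, fun hzN ↦ ?_, (hB.causalRel_of_near (chartClosedBall_mono x (by linarith)
    (chartBall_subset_chartClosedBall x _ hy)) hz htp ?_).mono (subset_univ _)⟩
  · have h1 := mem_ball_iff_norm.1 hzN.2
    rw [hze] at h1
    have h2 : ‖t • X‖ ≤ ‖φ y + t • X - φ x‖ + ‖φ y - φ x‖ := by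
      calc ‖t • X‖ = ‖(φ y + t • X - φ x) - (φ y - φ x)‖ := by congr 1; abel
        _ ≤ _ := norm_sub_le _ _
    linarith
  · rw [hze, show φ y + t • X - φ y - t • X = 0 by abel, norm_zero]
    positivity

end CausalRel

end TimeOrientedLorentzMetric

namespace TimeOrientedLorentzMetric

/-! ### Inextendible rays and extension of causal segments. -/

section Rays

variable {E : Type*} [NormedAddCommGroup E] [NormedSpace ℝ E]
  {M : Type*} [TopologicalSpace M] [ChartedSpace E M] [IsManifold 𝓘(ℝ, E) ∞ M]
  {g : TimeOrientedLorentzMetric E M}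

theorem isCausalOn_Ici {c : ℝ → M} (h : ∀ n : ℕ, g.IsCausalOn c (Icc 0 n)) :
    g.IsCausalOn c (Ici 0) := by
  have hn (t : ℝ) : ∃ n : ℕ, Icc (0 : ℝ) n ∈ 𝓝[Ici 0] t ∧ t < n := by
    obtain ⟨n, hn⟩ := exists_nat_gt t
    refine ⟨n, ?_, hn⟩
    rw [← Ici_inter_Iic]
    exact inter_mem self_mem_nhdsWithin (mem_nhdsWithin_of_mem_nhds (Iic_mem_nhds hn))
  refine ⟨fun t ht ↦ ?_, fun t ht ↦ ?_, ?_⟩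
  · obtain ⟨n, hn, htn⟩ := hn t
    exact ((h n).continuousOn t ⟨ht, htn.le⟩).mono_of_mem_nhdsWithin hn
  · obtain ⟨n, hn, htn⟩ := hn t
    obtain ⟨C, s, hs, hl⟩ := (h n).locallyLipschitz t ⟨ht, htn.le⟩
    exact ⟨C, s, nhdsWithin_le_of_mem hn hs, hl⟩
  · filter_upwards [ae_all_iff.2 fun n ↦ (h n).futureCausal] with t ht htI
    obtain ⟨n, hn⟩ := exists_nat_gt t
    rw [interior_Ici] at htI
    exact ht n (by rw [interior_Icc]; exact ⟨htI, hn⟩)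

/-- Infinitely many unit causal segments concatenate to a causal curve on a half line. -/
theorem exists_isCausalOn_Ici_of_segments {x : ℕ → M} (h : ∀ n, g.CausalRel univ (x n) (x (n + 1)))
    (hne : ∀ n, x n ≠ x (n + 1)) :
    ∃ c : ℝ → M, g.IsCausalOn c (Ici 0) ∧ ∀ n : ℕ, c n = x n := by
  choose s hs using fun n ↦ (h n).resolve_left (hne n)
  set c : ℝ → M := fun t ↦ s ⌊t⌋₊ (t - ⌊t⌋₊) with hc
  have hcn : ∀ n : ℕ, c n = x n := fun n ↦ by simp [hc, (hs n).2.1]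
  have hseg : ∀ n : ℕ, g.IsCausalOn c (Icc n (n + 1)) := fun n ↦ by
    have h1 := (hs n).1.shift n
    rw [zero_add, add_comm (1 : ℝ)] at h1
    refine h1.congr fun t ht ↦ ?_
    -- At the right endpoint the floor jumps to `n + 1`, so the formula uses the start of the next
    -- segment, which is the end of this one.
    rcases ht.2.eq_or_lt with rfl | hlt
    · have h2 := hcn (n + 1)
      push_cast at h2
      rw [h2]
      simp [(hs n).2.2.1]
    · have h2 : ⌊t⌋₊ = n := (Nat.floor_eq_iff ((Nat.cast_nonneg n).trans ht.1)).2 ⟨ht.1, hlt⟩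
      simp only [hc, h2]
  refine ⟨c, isCausalOn_Ici fun n ↦ ?_, hcn⟩
  induction n with
  | zero => simpa using isCausalOn_singleton c 0
  | succ n ih =>
    push_cast
    rw [← Icc_union_Icc_eq_Icc (Nat.cast_nonneg n) (by linarith : (n : ℝ) ≤ n + 1)]
    exact ih.union (hseg n) Icc_subset_Iic_self Icc_subset_Ici_self
      (right_mem_Icc.2 (Nat.cast_nonneg n)) (left_mem_Icc.2 (by linarith))

/-- A sequence along which each step leaves a ball of nearly maximal size, among the balls contained
in a member of a given family of neighbourhoods, does not converge. -/
theorem exists_nonconvergent_sequence {X : Type*} [MetricSpace X] {A : Set X} {r : X → X → Prop}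
    (hA : ∀ x, ∃ N ∈ 𝓝 x, ∀ y ∈ A ∩ N, ∃ z ∈ A \ N, r y z) {a : X} (ha : a ∈ A) :
    ∃ x : ℕ → X, x 0 = a ∧ (∀ n, x n ∈ A) ∧ (∀ n, r (x n) (x (n + 1))) ∧
      (∀ n, x n ≠ x (n + 1)) ∧ ∀ p, ¬ Tendsto x atTop (𝓝 p) := by
  choose N hN hstep using hA
  -- The cap at `1` keeps the supremum finite; it need not be attained, so radii are chosen within a
  -- factor of two of it.
  set good : X → Set ℝ := fun y ↦ {ρ | 0 < ρ ∧ ρ ≤ 1 ∧ ∃ x', Metric.ball y ρ ⊆ N x'} with hgood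
  have hbdd (y : X) : BddAbove (good y) := ⟨1, fun ρ hρ ↦ hρ.2.1⟩
  have hne (y : X) : (good y).Nonempty := by
    obtain ⟨ε, hε, h⟩ := Metric.mem_nhds_iff.1 (hN y)
    exact ⟨min ε 1, by positivity, min_le_right _ _, y,
      (Metric.ball_subset_ball (min_le_left _ _)).trans h⟩
  have hρ (y : X) : ∃ ρ ∈ good y, ∀ ρ' ∈ good y, ρ' ≤ 2 * ρ := by
    obtain ⟨ρ₀, hρ₀⟩ := hne y
    have hpos : 0 < sSup (good y) := hρ₀.1.trans_le (le_csSup (hbdd y) hρ₀)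
    obtain ⟨ρ, hρ, hlt⟩ := exists_lt_of_lt_csSup (hne y) (half_lt_self hpos)
    exact ⟨ρ, hρ, fun ρ' hρ' ↦ (le_csSup (hbdd y) hρ').trans (by linarith)⟩
  choose ρ hρg hρmax using hρ
  have hnext : ∀ y : A, ∃ z : A, r y z ∧ ρ y ≤ dist (z : X) y := by
    rintro ⟨y, hy⟩
    obtain ⟨hpos, -, x', hx'⟩ := hρg y
    obtain ⟨z, ⟨hzA, hzN⟩, hr⟩ := hstep x' y ⟨hy, hx' (Metric.mem_ball_self hpos)⟩
    exact ⟨⟨z, hzA⟩, hr, not_lt.1 fun h ↦ hzN (hx' h)⟩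
  choose f hfr hfd using hnext
  set x : ℕ → A := fun n ↦ f^[n] ⟨a, ha⟩ with hx
  have hsucc (n : ℕ) : x (n + 1) = f (x n) := Function.iterate_succ_apply' f n _
  refine ⟨fun n ↦ x n, rfl, fun n ↦ (x n).2, fun n ↦ ?_, fun n h ↦ ?_, fun p hp ↦ ?_⟩
  · simp only [hsucc]; exact hfr _
  · have h1 := hfd (x n)
    have h2 : (x n : X) = x (n + 1) := h
    rw [← hsucc, ← h2, dist_self] at h1
    exact h1.not_gt (hρg _).1
  -- Near a limit `p` the radius `η` is admissible, so steps have length at least `η / 2`; but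
  -- consecutive points within `η / 4` of `p` are closer than that.
  · obtain ⟨ε, hε, hball⟩ := Metric.mem_nhds_iff.1 (hN p)
    set η := min (ε / 2) 1 with hη
    have hηp : 0 < η := by positivity
    have hηε : η ≤ ε / 2 := min_le_left _ _
    obtain ⟨n, hn⟩ := (Metric.tendsto_atTop.1 hp (η / 4) (by positivity))
    have d1 := hn n le_rfl
    have d2 := hn (n + 1) (by omega)
    have hmem : η ∈ good (x n) := by
      refine ⟨hηp, min_le_right _ _, p, fun y hy ↦ hball ?_⟩
      have := Metric.mem_ball.1 hy
      exact Metric.mem_ball.2 ((dist_triangle y (x n) p).trans_lt (by linarith))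
    have h1 := hρmax _ η hmem
    have h2 := hfd (x n)
    rw [← hsucc] at h2
    have h3 := dist_triangle_right (x (n + 1) : X) (x n) p
    linarith

/-- If near every point the set `A` can be left while staying on it, then there are future
inextendible causal curves whose integer times lie in `A`. -/
theorem exists_ray_of_forall_exit [TopologicalSpace.MetrizableSpace M] {A : Set M}
    (hA : ∀ x, ∃ N ∈ 𝓝 x, ∀ y ∈ A ∩ N, ∃ z ∈ A \ N, g.CausalRel univ y z) {a : M} (ha : a ∈ A) :
    ∃ c : ℝ → M, g.IsCausalOn c (Ici 0) ∧ c 0 = a ∧ (∀ p, ¬ Tendsto c atTop (𝓝 p)) ∧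
      ∀ n : ℕ, c n ∈ A := by
  let _ := TopologicalSpace.metrizableSpaceMetric M
  obtain ⟨x, h0, hxA, hr, hne, hlim⟩ := exists_nonconvergent_sequence hA ha
  obtain ⟨c, hc, hcn⟩ := exists_isCausalOn_Ici_of_segments hr hne
  refine ⟨c, hc, by simpa [h0] using hcn 0, fun p hp ↦ hlim p ?_, fun n ↦ by rw [hcn]; exact hxA n⟩
  have := hp.comp tendsto_natCast_atTop_atTop
  exact this.congr fun n ↦ hcn n

/-- From every point starts a future inextendible causal curve. -/
theorem exists_ray [FiniteDimensional ℝ E] [TopologicalSpace.MetrizableSpace M]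
    (g : TimeOrientedLorentzMetric E M) (a : M) :
    ∃ c : ℝ → M, g.IsCausalOn c (Ici 0) ∧ c 0 = a ∧ ∀ p, ¬ Tendsto c atTop (𝓝 p) := by
  obtain ⟨c, h1, h2, h3, -⟩ := exists_ray_of_forall_exit (g := g) (A := univ) (fun x ↦ by
    obtain ⟨N, hN, h⟩ := g.exists_mem_nhds_exit x
    refine ⟨N, hN, fun y hy ↦ ?_⟩
    obtain ⟨z, hz, hr⟩ := h y hy.2
    exact ⟨z, ⟨mem_univ _, hz⟩, hr⟩) (mem_univ a)
  exact ⟨c, h1, h2, h3⟩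

/-- A causal curve on `(-∞, b]` continued by a future inextendible one. -/
theorem IsCausalOn.exists_glue_future {c r : ℝ → M} {b : ℝ} (hc : g.IsCausalOn c (Iic b))
    (hr : g.IsCausalOn r (Ici 0)) (h : r 0 = c b) (hlim : ∀ p, ¬ Tendsto r atTop (𝓝 p)) :
    ∃ γ : ℝ → M, g.IsCausalCurve γ ∧ EqOn γ c (Iic b) ∧ ∀ p, ¬ Tendsto γ atTop (𝓝 p) := by
  set γ : ℝ → M := fun t ↦ if t ≤ b then c t else r (t - b) with hγ
  have e1 : EqOn γ c (Iic b) := fun t (ht : t ≤ b) ↦ by simp [hγ, ht]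
  have e2 : EqOn γ (fun t ↦ r (1 * t + -b)) (Ici b) := fun t (ht : b ≤ t) ↦ by
    rcases ht.eq_or_lt with rfl | hlt
    · simp [hγ, h]
    · simp [hγ, hlt.not_ge, sub_eq_add_neg]
  have hr' := (hr.comp_affine one_pos (-b)).mono (J := Ici b) fun t (ht : b ≤ t) ↦ by
    change 0 ≤ 1 * t + -b
    linarith
  refine ⟨γ, ?_, e1, fun p hp ↦ hlim p ?_⟩
  · rw [← isCausalOn_univ_iff, ← Iic_union_Ici (a := b)]
    exact (hc.congr e1).union (hr'.congr e2) subset_rfl subset_rfl self_mem_Iic self_mem_Ici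
  · have h1 : Tendsto (fun t : ℝ ↦ t + b) atTop atTop := tendsto_atTop_add_const_right _ b tendsto_id
    refine (hp.comp h1).congr' ?_
    filter_upwards [eventually_ge_atTop 0] with t ht
    rw [Function.comp_apply, e2 (show b ≤ t + b by linarith)]
    simp

/-- A causal curve on `[a, b]` preceded by a past inextendible one. -/
theorem IsCausalOn.exists_glue_past {c r : ℝ → M} {a b : ℝ} (hc : g.IsCausalOn c (Icc a b))
    (hab : a ≤ b) (hr : g.reverse.IsCausalOn r (Ici 0)) (h : r 0 = c a)
    (hlim : ∀ p, ¬ Tendsto r atTop (𝓝 p)) :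
    ∃ γ : ℝ → M, g.IsCausalOn γ (Iic b) ∧ EqOn γ c (Icc a b) ∧
      EqOn γ (fun t ↦ r (a - t)) (Iic a) ∧ ∀ p, ¬ Tendsto γ atBot (𝓝 p) := by
  set γ : ℝ → M := fun t ↦ if t < a then r (a - t) else c t with hγ
  have e1 : EqOn γ c (Icc a b) := fun t ht ↦ by simp [hγ, ht.1]
  have e2 : EqOn γ (fun t ↦ r (a - t)) (Iic a) := fun t (ht : t ≤ a) ↦ by
    rcases ht.eq_or_lt with rfl | hlt
    · simp [hγ, h]
    · simp [hγ, hlt]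
  have hr' : g.IsCausalOn (fun t ↦ r (a - t)) (Iic a) := by
    have h1 := hr.reverse a
    rw [reverse_reverse] at h1
    refine (h1.mono (J := Iic a) fun t (ht : t ≤ a) ↦ ?_).congr fun t _ ↦ ?_
    · change 0 ≤ -1 * t + a
      linarith
    · change r (a - t) = r (-1 * t + a)
      congr 1; ring
  refine ⟨γ, ?_, e1, e2, fun p hp ↦ hlim p ?_⟩
  · rw [← Iic_union_Icc_eq_Iic hab]
    exact (hr'.congr e2).union (hc.congr e1) subset_rfl Icc_subset_Ici_self self_mem_Iic
      (left_mem_Icc.2 hab)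
  · have h1 : Tendsto (fun t : ℝ ↦ a - t) atTop atBot := by
      simpa [sub_eq_add_neg] using tendsto_atBot_add_const_left atTop a tendsto_neg_atTop_atBot
    refine (hp.comp h1).congr' ?_
    filter_upwards [eventually_ge_atTop 0] with t ht
    rw [Function.comp_apply, e2 (show a - t ≤ a by linarith)]
    simp

/-- Every causal curve on a compact interval extends to an inextendible causal curve, with any
prescribed past part. -/
theorem IsCausalOn.exists_inextendible_of_past [FiniteDimensional ℝ E]
    [TopologicalSpace.MetrizableSpace M] {c r : ℝ → M} {a b : ℝ} (hc : g.IsCausalOn c (Icc a b))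
    (hab : a ≤ b) (hr : g.reverse.IsCausalOn r (Ici 0)) (h : r 0 = c a)
    (hlim : ∀ p, ¬ Tendsto r atTop (𝓝 p)) :
    ∃ γ : ℝ → M, g.IsInextendibleCausalCurve univ γ ∧ EqOn γ c (Icc a b) ∧
      EqOn γ (fun t ↦ r (a - t)) (Iic a) := by
  obtain ⟨γ₁, h1, e1, e2, hbot⟩ := hc.exists_glue_past hab hr h hlim
  obtain ⟨r', hr', h0, hlim'⟩ := g.exists_ray (γ₁ b)
  obtain ⟨γ, h2, e3, htop⟩ := h1.exists_glue_future hr' h0 hlim'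
  refine ⟨γ, ⟨h2, fun _ ↦ mem_univ _, fun p _ ↦ htop p, fun p _ hp ↦ hbot p ?_⟩,
    fun t ht ↦ (e3 ht.2).trans (e1 ht), fun t (ht : t ≤ a) ↦ (e3 (ht.trans hab)).trans (e2 ht)⟩
  refine hp.congr' ?_
  filter_upwards [eventually_le_atBot b] with t ht using e3 ht

/-- Every causal curve on a compact interval extends to an inextendible causal curve. -/
theorem IsCausalOn.exists_inextendible [FiniteDimensional ℝ E]
    [TopologicalSpace.MetrizableSpace M] {c : ℝ → M} {a b : ℝ} (hc : g.IsCausalOn c (Icc a b))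
    (hab : a ≤ b) :
    ∃ γ : ℝ → M, g.IsInextendibleCausalCurve univ γ ∧ EqOn γ c (Icc a b) := by
  obtain ⟨r, hr, h0, hlim⟩ := g.reverse.exists_ray (c a)
  obtain ⟨γ, h1, h2, -⟩ := hc.exists_inextendible_of_past hab hr h0 hlim
  exact ⟨γ, h1, h2⟩

end Rays

end TimeOrientedLorentzMetric

namespace TimeOrientedLorentzMetric

/-! ### Future and past of a Cauchy surface, and compactness of J⁻(p) ∩ J⁺(S). -/

section CauchySurfaces

variable {E : Type*} [NormedAddCommGroup E] [NormedSpace ℝ E]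
  {M : Type*} [TopologicalSpace M] [ChartedSpace E M] [IsManifold 𝓘(ℝ, E) ∞ M]
  {g : TimeOrientedLorentzMetric E M} {S : Set M}

/-- The causal future of a set. The causal past is the causal future for the reversed metric. -/
def causalFuture (g : TimeOrientedLorentzMetric E M) (S : Set M) : Set M :=
  {p | ∃ s ∈ S, g.CausalRel univ s p}

theorem subset_causalFuture (g : TimeOrientedLorentzMetric E M) (S : Set M) :
    S ⊆ g.causalFuture S := fun s hs ↦ ⟨s, hs, CausalRel.refl g s⟩

theorem mem_causalFuture_of_causalRel {p q : M} (hp : p ∈ g.causalFuture S)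
    (h : g.CausalRel univ p q) : q ∈ g.causalFuture S := by
  obtain ⟨s, hs, hsp⟩ := hp
  exact ⟨s, hs, hsp.trans h⟩

theorem mem_causalPast_of_causalRel {p q : M} (hq : q ∈ g.reverse.causalFuture S)
    (h : g.CausalRel univ p q) : p ∈ g.reverse.causalFuture S :=
  mem_causalFuture_of_causalRel hq h.reverse

theorem IsInextendibleCausalCurve.reverse {V : Set M} {γ : ℝ → M}
    (h : g.IsInextendibleCausalCurve V γ) :
    g.reverse.IsInextendibleCausalCurve V (fun t ↦ γ (-t)) where
  isCausalCurve := by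
    have h1 := (isCausalOn_univ_iff.2 h.isCausalCurve).reverse 0
    rw [preimage_univ] at h1
    simpa using isCausalOn_univ_iff.1 h1
  mem t := h.mem (-t)
  no_future_endpoint p hp hlim := h.no_past_endpoint p hp (by
    simpa [Function.comp_def] using hlim.comp tendsto_neg_atBot_atTop)
  no_past_endpoint p hp hlim := h.no_future_endpoint p hp (by
    simpa [Function.comp_def] using hlim.comp tendsto_neg_atTop_atBot)

theorem IsCauchySurface.reverse {V : Set M} (hS : g.IsCauchySurface V S) :
    g.reverse.IsCauchySurface V S where
  subset := hS.subset
  closed := hS.closed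
  meets_exactly_once γ hγ := by
    have h1 := hγ.reverse
    rw [reverse_reverse] at h1
    obtain ⟨t, ht, huniq⟩ := hS.meets_exactly_once _ h1
    refine ⟨-t, ht, fun s hs ↦ ?_⟩
    rw [← huniq (-s) (by simpa using hs), neg_neg]

theorem IsCauchySurface.isClosed (hS : g.IsCauchySurface univ S) : IsClosed S :=
  closure_subset_iff_isClosed.1 (by simpa using hS.closed)

variable [FiniteDimensional ℝ E] [TopologicalSpace.MetrizableSpace M]

/-- The definition speaks only of inextendible curves; extending the segment carries uniqueness over
to it, so Cauchy surfaces are acausal. -/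
theorem IsCauchySurface.not_mem_twice (hS : g.IsCauchySurface univ S) {c : ℝ → M} {a b : ℝ}
    (hc : g.IsCausalOn c (Icc a b)) (hab : a < b) (ha : c a ∈ S) (hb : c b ∈ S) : False := by
  obtain ⟨γ, hγ, he⟩ := hc.exists_inextendible hab.le
  refine hab.ne ((hS.meets_exactly_once γ hγ).unique ?_ ?_)
  · rwa [he (left_mem_Icc.2 hab.le)]
  · rwa [he (right_mem_Icc.2 hab.le)]

theorem IsCauchySurface.eq_of_causalRel (hS : g.IsCauchySurface univ S) {p q : M} (hp : p ∈ S)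
    (hq : q ∈ S) (h : g.CausalRel univ p q) : p = q := by
  rcases h with h | ⟨c, hc, rfl, rfl, -⟩
  · exact h
  · exact (hS.not_mem_twice hc one_pos hp hq).elim

/-- Joining a nontrivial curve from `S` to `p` to one from `p` back to `S` would violate acausality.
-/
theorem IsCauchySurface.mem_of_mem_future_of_mem_past (hS : g.IsCauchySurface univ S) {p : M}
    (h1 : p ∈ g.causalFuture S) (h2 : p ∈ g.reverse.causalFuture S) : p ∈ S := by
  obtain ⟨s, hs, hsp⟩ := h1
  obtain ⟨t, ht, htp⟩ := h2
  rw [causalRel_reverse_iff] at htp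
  rcases hsp with rfl | ⟨c₁, hc₁, h0, h1, -⟩
  · exact hs
  rcases htp with rfl | ⟨c₂, hc₂, h0', h1', -⟩
  · exact ht
  have hsh := hc₂.shift 1
  norm_num at hsh
  obtain ⟨c, hc, e1, e2⟩ := exists_isCausalOn_concat hc₁ hsh zero_le_one one_le_two
    (by simp [h1, h0'])
  refine (hS.not_mem_twice hc two_pos ?_ ?_).elim
  · rw [e1 (by simp), h0]; exact hs
  · rw [e2 (by simp : (2 : ℝ) ∈ Icc (1 : ℝ) 2)]
    norm_num
    rwa [h1']

/-- A causal segment that does not meet a Cauchy surface comes from its future or goes to its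
past. -/
theorem IsCauchySurface.future_or_past_of_segment (hS : g.IsCauchySurface univ S) {c : ℝ → M}
    {a b : ℝ} (hc : g.IsCausalOn c (Icc a b)) (hab : a ≤ b) (hcS : ∀ t ∈ Icc a b, c t ∉ S) :
    c a ∈ g.causalFuture S ∨ c b ∈ g.reverse.causalFuture S := by
  obtain ⟨γ, hγ, he⟩ := hc.exists_inextendible hab
  obtain ⟨t, ht, -⟩ := hS.meets_exactly_once γ hγ
  have hγ' := isCausalOn_univ_iff.2 hγ.isCausalCurve
  rcases le_total t a with h | h
  · left
    rw [← he (left_mem_Icc.2 hab)]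
    exact ⟨γ t, ht, hγ'.causalRel_univ (mem_univ _) (mem_univ _) h⟩
  rcases le_total t b with h' | h'
  · exact absurd (he ⟨h, h'⟩ ▸ ht) (hcS t ⟨h, h'⟩)
  · right
    rw [← he (right_mem_Icc.2 hab)]
    exact ⟨γ t, ht, (hγ'.causalRel_univ (mem_univ _) (mem_univ _) h').reverse⟩

theorem IsCauchySurface.mem_future_or_past (hS : g.IsCauchySurface univ S) (p : M) :
    p ∈ g.causalFuture S ∨ p ∈ g.reverse.causalFuture S := by
  by_cases hp : p ∈ S
  · exact Or.inl (subset_causalFuture g S hp)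
  · refine hS.future_or_past_of_segment (c := fun _ ↦ p) (a := 0) (b := 0) ?_ le_rfl
      fun _ _ ↦ hp
    rw [Icc_self]
    exact isCausalOn_singleton _ _

/-- Step back from `p` to a point `y` along a curve that avoids `S`. Then `y` is still in J⁺(S),
since otherwise `p` would also lie in J⁻(S), hence on `S`; and the future of `y` is a neighbourhood
of `p`. -/
theorem IsCauchySurface.causalFuture_mem_nhds (hS : g.IsCauchySurface univ S) {p : M}
    (hp : p ∈ g.causalFuture S) (hpS : p ∉ S) : g.causalFuture S ∈ 𝓝 p := by
  obtain ⟨y, hy, hnhds⟩ := g.exists_past_mem_nhds p (hS.isClosed.isOpen_compl.mem_nhds hpS)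
  have hyF : y ∈ g.causalFuture S := by
    rcases hy with rfl | ⟨c, hc, rfl, rfl, hcS⟩
    · exact hp
    · exact (hS.future_or_past_of_segment hc zero_le_one fun t ht ↦ hcS ht).resolve_right
        fun h ↦ hpS (hS.mem_of_mem_future_of_mem_past hp h)
  exact mem_of_superset hnhds fun z hz ↦ mem_causalFuture_of_causalRel hyF hz

/-- The complement is J⁻(S) without `S`, which is open by the reversed form of
`causalFuture_mem_nhds`. -/
theorem IsCauchySurface.isClosed_causalFuture (hS : g.IsCauchySurface univ S) :
    IsClosed (g.causalFuture S) := by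
  rw [← isOpen_compl_iff, isOpen_iff_mem_nhds]
  intro p hp
  have hpS : p ∉ S := fun h ↦ hp (subset_causalFuture g S h)
  have hpast := (hS.mem_future_or_past p).resolve_left hp
  filter_upwards [hS.reverse.causalFuture_mem_nhds hpast hpS, hS.isClosed.isOpen_compl.mem_nhds hpS]
    with q hq hqS hqF
  exact hqS (hS.mem_of_mem_future_of_mem_past hqF hq)

omit [TopologicalSpace.MetrizableSpace M] in
/-- A causal curve which ends inside a coordinate ball has a last piece inside the closed ball that
starts either at the start of the curve or outside of the open ball. -/
theorem IsCausalBox.exists_last_entrance [T2Space M] {x y q : M} {l : E →L[ℝ] ℝ} {κ δ R : ℝ}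
    (hB : g.IsCausalBox x l κ δ R) (hy : y ∈ chartBall E x R) (h : g.CausalRel univ q y) :
    ∃ z ∈ chartClosedBall E x R, g.CausalRel (chartClosedBall E x R) z y ∧
      g.CausalRel univ q z ∧ (z = q ∨ z ∉ chartBall E x R) := by
  have hsub := chartBall_subset_chartClosedBall (E := E) x R
  have hclosed := (isCompact_chartClosedBall hB.subset_target).isClosed
  rcases h with rfl | ⟨c, hc, rfl, rfl, -⟩
  · exact ⟨q, hsub hy, Or.inl rfl, Or.inl rfl, Or.inl rfl⟩
  -- The greatest parameter outside the open ball marks the last entrance.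
  have hT : IsCompact (Icc (0 : ℝ) 1 ∩ c ⁻¹' (chartBall E x R)ᶜ) :=
    isCompact_Icc.of_isClosed_subset (hc.continuousOn.preimage_isClosed_of_isClosed isClosed_Icc
      (isOpen_chartBall x R).isClosed_compl) inter_subset_left
  rcases (Icc (0 : ℝ) 1 ∩ c ⁻¹' (chartBall E x R)ᶜ).eq_empty_or_nonempty with he | hne
  · have hin : MapsTo c (Icc 0 1) (chartClosedBall E x R) := fun t ht ↦ hsub (by
      by_contra hn
      exact (he ▸ (⟨ht, hn⟩ : t ∈ Icc (0 : ℝ) 1 ∩ c ⁻¹' (chartBall E x R)ᶜ) : t ∈ (∅ : Set ℝ)))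
    exact ⟨c 0, hin (by simp), hc.causalRel zero_le_one hin, Or.inl rfl, Or.inl rfl⟩
  · obtain ⟨t, ⟨ht, htN⟩, hmax⟩ := hT.exists_isGreatest hne
    have hlt : t < 1 := lt_of_le_of_ne ht.2 (by rintro rfl; exact htN hy)
    have hafter : ∀ s ∈ Ioc t 1, c s ∈ chartBall E x R := fun s hs ↦ by
      by_contra hn
      exact hs.1.not_ge (hmax ⟨⟨ht.1.trans hs.1.le, hs.2⟩, hn⟩)
    have hmem : c t ∈ chartClosedBall E x R := by
      rw [← hclosed.closure_eq]
      refine ContinuousWithinAt.mem_closure (s := Ioc t 1) ((hc.continuousOn t ht).mono ?_) ?_ ?_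
      · exact fun s hs ↦ ⟨ht.1.trans hs.1.le, hs.2⟩
      · rw [closure_Ioc hlt.ne]; exact left_mem_Icc.2 hlt.le
      · exact fun s hs ↦ hsub (hafter s hs)
    refine ⟨c t, hmem, (hc.mono (Icc_subset_Icc_left ht.1)).causalRel hlt.le fun s hs ↦ ?_,
      (hc.mono (Icc_subset_Icc_right ht.2)).causalRel ht.1 (mapsTo_univ _ _), Or.inr htN⟩
    rcases hs.1.eq_or_lt with rfl | h
    · exact hmem
    · exact hsub (hafter s ⟨h, hs.2⟩)

/-- Compactness of the causal diamonds between a Cauchy surface and a convergent sequence. -/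
theorem IsCauchySurface.exists_limit (hS : g.IsCauchySurface univ S) {ι : Type*}
    (U : Ultrafilter ι) {u q : ι → M} {p : M} (hu : Tendsto u U (𝓝 p))
    (hq : ∀ᶠ k in U, g.CausalRel univ (q k) (u k) ∧ q k ∈ g.causalFuture S) :
    ∃ x, Tendsto q U (𝓝 x) ∧ g.CausalRel univ x p ∧ x ∈ g.causalFuture S := by
  by_contra hno
  have hFc := hS.isClosed_causalFuture
  -- Limits of points that follow `q k`, themselves preceding `p`. The set contains `p` and lies in
  -- the closed set J⁺(S).
  set A : Set M := {x | g.CausalRel univ x p ∧ ∃ x' : ι → M, Tendsto x' U (𝓝 x) ∧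
    ∀ᶠ k in U, g.CausalRel univ (q k) (x' k)} with hA
  have hAF : ∀ x ∈ A, x ∈ g.causalFuture S := by
    rintro x ⟨-, x', hx', hr⟩
    refine hFc.mem_of_tendsto hx' ?_
    filter_upwards [hr, hq] with k h1 h2 using mem_causalFuture_of_causalRel h2.2 h1
  have hexit : ∀ x, ∃ N ∈ 𝓝 x, ∀ y ∈ A ∩ N, ∃ z ∈ A \ N, g.reverse.CausalRel univ y z := by
    intro x
    obtain ⟨l, κ, δ, R, hB, -⟩ := g.exists_isCausalBox x univ_mem
    have hN := (isOpen_chartBall (E := E) x R).mem_nhds (mem_chartBall_self x hB.R_pos)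
    refine ⟨chartBall E x R, hN, ?_⟩
    rintro y ⟨⟨hyp, y', hy', hr⟩, hyN⟩
    have hev : ∀ᶠ k in U, ∃ z ∈ chartClosedBall E x R,
        g.CausalRel (chartClosedBall E x R) z (y' k) ∧ g.CausalRel univ (q k) z ∧
          (z = q k ∨ z ∉ chartBall E x R) := by
      filter_upwards [hr, hy' ((isOpen_chartBall x R).mem_nhds hyN)] with k h1 h2
      exact hB.exists_last_entrance h2 h1
    obtain ⟨z', hz'⟩ : ∃ z' : ι → M, ∀ᶠ k in U, z' k ∈ chartClosedBall E x R ∧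
        g.CausalRel (chartClosedBall E x R) (z' k) (y' k) ∧ g.CausalRel univ (q k) (z' k) ∧
          (z' k = q k ∨ z' k ∉ chartBall E x R) := hev.choice
    -- The last entrances into the ball converge to a point of `A` preceding `y`. Were it inside the
    -- open ball, the entrances would eventually equal `q k`, which would then converge.
    obtain ⟨z, hz, hlim⟩ := exists_ultrafilter_limit
      (isCompact_chartClosedBall hB.subset_target) U (hz'.mono fun k hk ↦ hk.1)
    have hzy : g.CausalRel univ z y :=
      hB.causalRel_of_tendsto U hlim hy' (hz'.mono fun k hk ↦ ⟨hk.1, hk.2.1⟩)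
    have hzA : z ∈ A := ⟨hzy.trans hyp, z', hlim, hz'.mono fun k hk ↦ hk.2.2.1⟩
    refine ⟨z, ⟨hzA, fun hzN ↦ hno ⟨z, ?_, hzA.1, hAF z hzA⟩⟩, hzy.reverse⟩
    refine hlim.congr' ?_
    filter_upwards [hz', hlim ((isOpen_chartBall x R).mem_nhds hzN)] with k h1 h2
    exact h1.2.2.2.resolve_right fun h ↦ h h2
  have hpA : p ∈ A := ⟨CausalRel.refl g p, u, hu, hq.mono fun k hk ↦ hk.1⟩
  obtain ⟨r, hr, hr0, hrlim, hrA⟩ := exists_ray_of_forall_exit hexit hpA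
  have hsing : g.IsCausalOn (fun _ ↦ p) (Icc 0 0) := by
    rw [Icc_self]; exact isCausalOn_singleton _ _
  obtain ⟨γ, hγ, -, he⟩ := hsing.exists_inextendible_of_past le_rfl hr hr0 hrlim
  obtain ⟨t, ht, huniq⟩ := hS.meets_exactly_once γ hγ
  -- The point `γ (-n)` comes before the crossing of `S` at `t` but lies in J⁺(S), hence on `S`: a
  -- second crossing.
  obtain ⟨n, hn⟩ := exists_nat_gt (-t)
  have hγn : γ (-n) = r n := by
    rw [he (show (-n : ℝ) ≤ 0 by simp)]; simp
  have hlt : (-n : ℝ) < t := by linarith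
  have hrel : g.CausalRel univ (γ (-n)) (γ t) :=
    (isCausalOn_univ_iff.2 hγ.isCausalCurve).causalRel_univ (mem_univ _) (mem_univ _) hlt.le
  refine hlt.ne (huniq _ (hS.mem_of_mem_future_of_mem_past ?_ ?_))
  · rw [hγn]; exact hAF _ (hrA n)
  · exact ⟨γ t, ht, hrel.reverse⟩

end CauchySurfaces

end TimeOrientedLorentzMetric

namespace TimeOrientedLorentzMetric

/-! ### Sets controlled by the surface, and their own Cauchy surfaces. -/

section PastConvex

variable {E : Type*} [NormedAddCommGroup E] [NormedSpace ℝ E] [FiniteDimensional ℝ E]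
  {M : Type*} [TopologicalSpace M] [ChartedSpace E M] [IsManifold 𝓘(ℝ, E) ∞ M]
  [TopologicalSpace.MetrizableSpace M]
  {g : TimeOrientedLorentzMetric E M} {S : Set M}

/-- A past endpoint of a causal curve precedes its points. -/
theorem IsCausalCurve.causalRel_of_tendsto_atBot {γ : ℝ → M} (hγ : g.IsCausalCurve γ) {p : M}
    (hp : Tendsto γ atBot (𝓝 p)) (t : ℝ) : g.CausalRel univ p (γ t) := by
  have hγ' := isCausalOn_univ_iff.2 hγ
  obtain ⟨l, κ, δ, R, hB, -⟩ := g.exists_isCausalBox p univ_mem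
  obtain ⟨T, hT⟩ := eventually_atBot.1
    (hp ((isOpen_chartBall (E := E) p R).mem_nhds (mem_chartBall_self p hB.R_pos)))
  have hmem : ∀ s ≤ T, γ s ∈ chartClosedBall E p R := fun s hs ↦
    chartBall_subset_chartClosedBall p R (hT s hs)
  set T' := min T t
  have h1 : g.CausalRel univ p (γ T') := by
    refine hB.causalRel_of_tendsto (Ultrafilter.of atBot) (u := γ) (w := fun _ ↦ γ T')
      (hp.mono_left (Ultrafilter.of_le _)) tendsto_const_nhds ?_
    refine Ultrafilter.of_le _ ?_
    filter_upwards [eventually_le_atBot T'] with s hs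
    exact ⟨hmem s (hs.trans (min_le_left _ _)), (hγ'.mono (subset_univ _)).causalRel hs
      fun r hr ↦ hmem r (hr.2.trans (min_le_left _ _))⟩
  exact h1.trans (hγ'.causalRel_univ (mem_univ _) (mem_univ _) (min_le_right _ _))

/-- If `V` contains, with each point in the future of `S`, the causal curves joining it to `S`, then
inextendible causal curves of `V` through a point in the future of `S` meet `S`. -/
theorem IsCauchySurface.exists_mem_of_past_convex (hS : g.IsCauchySurface univ S) {V : Set M}
    (hV : ∀ p ∈ V, ∀ q, g.CausalRel univ q p → q ∈ g.causalFuture S → q ∈ V) {γ : ℝ → M}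
    (hγ : g.IsInextendibleCausalCurve V γ) (h0 : γ 0 ∈ g.causalFuture S) : ∃ t, γ t ∈ S := by
  by_contra! hn
  have hγ' := isCausalOn_univ_iff.2 hγ.isCausalCurve
  have hnotpast : γ 0 ∉ g.reverse.causalFuture S := fun h ↦
    hn 0 (hS.mem_of_mem_future_of_mem_past h0 h)
  have hF : ∀ t ≤ 0, γ t ∈ g.causalFuture S := fun t ht ↦
    (hS.future_or_past_of_segment (hγ'.mono (subset_univ _)) ht fun s _ ↦ hn s).resolve_right
      hnotpast
  -- A past endpoint in `M` would lie in the closed set J⁺(S) and precede `γ 0`, hence lie in `V`.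
  have hlim : ∀ p, ¬ Tendsto γ atBot (𝓝 p) := by
    intro p hp
    have hpF : p ∈ g.causalFuture S :=
      hS.isClosed_causalFuture.mem_of_tendsto hp ((eventually_le_atBot 0).mono hF)
    exact hγ.no_past_endpoint p
      (hV _ (hγ.mem 0) p (hγ.isCausalCurve.causalRel_of_tendsto_atBot hp 0) hpF) hp
  -- Towards the future `γ` may end in `M` outside `V`, so after parameter `0` it is replaced by a
  -- ray of `M`; a crossing on that ray would place `γ 0` in J⁻(S).
  obtain ⟨r, hr, hr0, hrlim⟩ := g.exists_ray (γ 0)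
  obtain ⟨γ₁, h1, he, htop⟩ := (hγ'.mono (subset_univ (Iic 0))).exists_glue_future hr hr0 hrlim
  obtain ⟨t, ht, -⟩ := hS.meets_exactly_once γ₁ ⟨h1, fun _ ↦ mem_univ _, fun p _ ↦ htop p,
    fun p _ hp ↦ hlim p (hp.congr' ((eventually_le_atBot 0).mono fun s hs ↦ he hs))⟩
  rcases le_total t 0 with h | h
  · exact hn t (he h ▸ ht)
  · refine hnotpast ⟨γ₁ t, ht, ?_⟩
    rw [← he (self_mem_Iic : (0 : ℝ) ∈ Iic 0)]
    exact ((isCausalOn_univ_iff.2 h1).causalRel_univ (mem_univ _) (mem_univ _) h).reverse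

/-- The points all of whose causal predecessors in the future of `S` lie in `U`. -/
def pastInterior (g : TimeOrientedLorentzMetric E M) (S U : Set M) : Set M :=
  {p | ∀ q, g.CausalRel univ q p → q ∈ g.causalFuture S → q ∈ U}

/-- The points which `S` controls inside `U`: all causal curves joining them to `S` stay in `U`. -/
def surfaceInterior (g : TimeOrientedLorentzMetric E M) (S U : Set M) : Set M :=
  g.pastInterior S U ∩ g.reverse.pastInterior S U

omit [FiniteDimensional ℝ E] [TopologicalSpace.MetrizableSpace M] in
theorem surfaceInterior_reverse (S U : Set M) :
    g.reverse.surfaceInterior S U = g.surfaceInterior S U := by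
  rw [surfaceInterior, surfaceInterior, reverse_reverse, inter_comm]

omit [FiniteDimensional ℝ E] [TopologicalSpace.MetrizableSpace M] in
theorem surfaceInterior_mono {U U' : Set M} (h : U ⊆ U') :
    g.surfaceInterior S U ⊆ g.surfaceInterior S U' :=
  fun _ hp ↦ ⟨fun q h1 h2 ↦ h (hp.1 q h1 h2), fun q h1 h2 ↦ h (hp.2 q h1 h2)⟩

/-- Bad predecessors outside `U` of points tending to `p` would, by `exists_limit`, converge to a
predecessor of `p` in J⁺(S). That limit lies in the open set `U`. -/
theorem IsCauchySurface.isOpen_pastInterior (hS : g.IsCauchySurface univ S) {U : Set M}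
    (hU : IsOpen U) : IsOpen (g.pastInterior S U) := by
  rw [isOpen_iff_mem_nhds]
  intro p hp
  rw [mem_iff_ultrafilter]
  intro F hF
  by_contra hn
  have hFp : ∀ᶠ x in F, x ∉ g.pastInterior S U := Ultrafilter.eventually_not.2 hn
  have hq : ∀ᶠ x in F, ∃ q, (g.CausalRel univ q x ∧ q ∈ g.causalFuture S) ∧ q ∉ U := by
    filter_upwards [hFp] with x hx
    simp only [pastInterior, mem_ofPred_eq, not_forall] at hx
    obtain ⟨q, h1, h2, h3⟩ := hx
    exact ⟨q, ⟨h1, h2⟩, h3⟩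
  obtain ⟨q, hq⟩ : ∃ q : M → M, ∀ᶠ x in F,
    (g.CausalRel univ (q x) x ∧ q x ∈ g.causalFuture S) ∧ q x ∉ U := hq.choice
  obtain ⟨y, hy, hyp, hyF⟩ := hS.exists_limit F (u := fun x ↦ x) hF (hq.mono fun x hx ↦ hx.1)
  obtain ⟨x, h1, h2⟩ := (hq.and (hy (hU.mem_nhds (hp y hyp hyF)))).exists
  exact h1.2 h2

/-- The same compactness for a fixed `p`: predecessors `q n` outside `U n` would converge along a
nonprincipal ultrafilter, into some `U m`. -/
theorem IsCauchySurface.exists_mem_pastInterior (hS : g.IsCauchySurface univ S) {U : ℕ → Set M}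
    (hU : ∀ n, IsOpen (U n)) (hmono : Monotone U) (hcover : ⋃ n, U n = univ) (p : M) :
    ∃ n, p ∈ g.pastInterior S (U n) := by
  by_contra! hn
  simp only [pastInterior, mem_ofPred_eq, not_forall] at hn
  choose q h1 h2 h3 using hn
  obtain ⟨y, hy, -, -⟩ := hS.exists_limit (hyperfilter ℕ) (u := fun _ ↦ p) tendsto_const_nhds
    (Eventually.of_forall fun n ↦ ⟨h1 n, h2 n⟩)
  obtain ⟨m, hm⟩ := mem_iUnion.1 (hcover ▸ mem_univ y)
  have hge : ∀ᶠ n in (hyperfilter ℕ : Filter ℕ), m ≤ n :=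
    Nat.hyperfilter_le_atTop (eventually_ge_atTop m)
  obtain ⟨n, hn1, hn2⟩ := (hge.and (hy ((hU m).mem_nhds hm))).exists
  exact h3 n (hmono hn1 hn2)

theorem IsCauchySurface.isOpen_surfaceInterior (hS : g.IsCauchySurface univ S) {U : Set M}
    (hU : IsOpen U) : IsOpen (g.surfaceInterior S U) :=
  (hS.isOpen_pastInterior hU).inter (hS.reverse.isOpen_pastInterior hU)

theorem IsCauchySurface.surfaceInterior_subset (hS : g.IsCauchySurface univ S) (U : Set M) :
    g.surfaceInterior S U ⊆ U := fun p hp ↦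
  (hS.mem_future_or_past p).elim (hp.1 p (CausalRel.refl g p))
    (hp.2 p (CausalRel.refl g.reverse p))

theorem IsCauchySurface.iUnion_surfaceInterior (hS : g.IsCauchySurface univ S) {U : ℕ → Set M}
    (hU : ∀ n, IsOpen (U n)) (hmono : Monotone U) (hcover : ⋃ n, U n = univ) :
    ⋃ n, g.surfaceInterior S (U n) = univ := by
  refine eq_univ_of_forall fun p ↦ ?_
  obtain ⟨m, hm⟩ := hS.exists_mem_pastInterior hU hmono hcover p
  obtain ⟨n, hn⟩ := hS.reverse.exists_mem_pastInterior hU hmono hcover p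
  exact mem_iUnion.2 ⟨max m n, fun q h1 h2 ↦ hmono (le_max_left m n) (hm q h1 h2),
    fun q h1 h2 ↦ hmono (le_max_right m n) (hn q h1 h2)⟩

/-- The past condition is transitivity. For the future one, a point of J⁻(S) after `q` in J⁺(S)
forces both onto `S`, where acausality identifies them. -/
theorem IsCauchySurface.mem_surfaceInterior_of_causalRel (hS : g.IsCauchySurface univ S)
    {U : Set M} {p q : M} (hp : p ∈ g.surfaceInterior S U) (hqp : g.CausalRel univ q p)
    (hq : q ∈ g.causalFuture S) : q ∈ g.surfaceInterior S U := by
  refine ⟨fun r hrq hr ↦ hp.1 r (hrq.trans hqp) hr, fun r hrq hr ↦ ?_⟩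
  rw [causalRel_reverse_iff] at hrq
  have hqS := hS.mem_of_mem_future_of_mem_past hq (mem_causalPast_of_causalRel hr hrq)
  have hrS := hS.mem_of_mem_future_of_mem_past (mem_causalFuture_of_causalRel hq hrq) hr
  rw [← hS.eq_of_causalRel hqS hrS hrq]
  exact hp.1 q hqp hq

theorem IsCauchySurface.isCauchySurface_surfaceInterior (hS : g.IsCauchySurface univ S)
    (U : Set M) :
    g.IsCauchySurface (g.surfaceInterior S U) (S ∩ g.surfaceInterior S U) where
  subset := inter_subset_right
  closed := fun p hp ↦ ⟨hS.isClosed.closure_subset (closure_mono inter_subset_left hp.1), hp.2⟩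
  meets_exactly_once γ hγ := by
    have hex : ∃ t, γ t ∈ S := by
      rcases hS.mem_future_or_past (γ 0) with h | h
      · exact hS.exists_mem_of_past_convex
          (fun p hp q h1 h2 ↦ hS.mem_surfaceInterior_of_causalRel hp h1 h2) hγ h
      · have hrev : ∀ p ∈ g.surfaceInterior S U, ∀ q, g.reverse.CausalRel univ q p →
            q ∈ g.reverse.causalFuture S → q ∈ g.surfaceInterior S U := by
          intro p hp q h1 h2
          rw [← surfaceInterior_reverse] at hp ⊢
          exact hS.reverse.mem_surfaceInterior_of_causalRel hp h1 h2
        obtain ⟨t, ht⟩ := hS.reverse.exists_mem_of_past_convex hrev hγ.reverse (by simpa using h)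
        exact ⟨-t, ht⟩
    obtain ⟨t, ht⟩ := hex
    refine ⟨t, ⟨ht, hγ.mem t⟩, fun s hs ↦ ?_⟩
    have hγ' := isCausalOn_univ_iff.2 hγ.isCausalCurve
    rcases lt_trichotomy s t with h | h | h
    · exact (hS.not_mem_twice (hγ'.mono (subset_univ _)) h hs.1 ht).elim
    · exact h
    · exact (hS.not_mem_twice (hγ'.mono (subset_univ _)) h ht hs.1).elim

/-- For `p` in J⁺(S), an open set of later points inside the closure meets the set itself, and a
predecessor in J⁺(S) of a member is a member. Thus taking closures to get compact sets does not
enlarge the interiors. -/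
theorem IsCauchySurface.interior_closure_surfaceInterior (hS : g.IsCauchySurface univ S)
    {U : Set M} (hU : IsOpen U) :
    interior (closure (g.surfaceInterior S U)) = g.surfaceInterior S U := by
  refine Subset.antisymm (fun p hp ↦ ?_)
    (interior_maximal subset_closure (hS.isOpen_surfaceInterior hU))
  have key : ∀ g' : TimeOrientedLorentzMetric E M, g'.IsCauchySurface univ S →
      p ∈ interior (closure (g'.surfaceInterior S U)) → p ∈ g'.causalFuture S →
      p ∈ g'.surfaceInterior S U := by
    intro g' hS' hp hpF
    obtain ⟨O, hO, hOo, ⟨y, hy⟩, hOf⟩ :=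
      g'.exists_open_subset_future p (isOpen_interior.mem_nhds hp)
    obtain ⟨z, hz, hzV⟩ := mem_closure_iff.1 (interior_subset (hO hy)) O hOo hy
    exact hS'.mem_surfaceInterior_of_causalRel hzV (hOf z hz) hpF
  rcases hS.mem_future_or_past p with h | h
  · exact key g hS hp h
  · rw [← surfaceInterior_reverse] at hp ⊢
    exact key _ hS.reverse hp h

end PastConvex

end TimeOrientedLorentzMetric

/-! ### The compact exhaustion. -/

theorem lemma3p1 {E : Type*} [NormedAddCommGroup E] [NormedSpace ℝ E] [FiniteDimensional ℝ E]
    {M : Type*} [TopologicalSpace M] [T2Space M] [SecondCountableTopology M]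
    [ChartedSpace E M] [IsManifold 𝓘(ℝ, E) ∞ M]
    (g : TimeOrientedLorentzMetric E M) (hg : g.GloballyHyperbolic univ) :
    ∃ S : Set M, g.IsCauchySurface univ S ∧
      ∃ K : ℕ → Set M,
        (∀ n, IsCompact (K n)) ∧
        (∀ n, K n ⊆ interior (K (n + 1))) ∧
        (⋃ n, K n) = univ ∧
        ∀ n, g.GloballyHyperbolic (interior (K n)) ∧
          g.IsCauchySurface (interior (K n)) (S ∩ interior (K n)) := by
  obtain ⟨S, hS⟩ := hg
  have : LocallyCompactSpace M := ChartedSpace.locallyCompactSpace E M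
  have : TopologicalSpace.MetrizableSpace M :=
    TopologicalSpace.metrizableSpace_of_t3_secondCountable M
  let C : CompactExhaustion M := default
  set U : ℕ → Set M := fun n ↦ interior (C n)
  have hU (n : ℕ) : IsOpen (U n) := isOpen_interior
  have hmono : Monotone U := fun m n h ↦ interior_mono (C.subset h)
  have hcover : ⋃ n, U n = univ := eq_univ_of_forall fun p ↦
    mem_iUnion.2 ⟨C.find p + 1, C.subset_interior_succ _ (C.mem_find p)⟩
  set V : ℕ → Set M := fun n ↦ g.surfaceInterior S (U n)
  have hVo (n : ℕ) : IsOpen (V n) := hS.isOpen_surfaceInterior (hU n)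
  have hVmono : Monotone V := fun m n h ↦
    TimeOrientedLorentzMetric.surfaceInterior_mono (hmono h)
  have hVcover : ⋃ n, V n = univ := hS.iUnion_surfaceInterior hU hmono hcover
  have hVc (n : ℕ) : IsCompact (closure (V n)) :=
    (C.isCompact n).closure_of_subset ((hS.surfaceInterior_subset (U n)).trans interior_subset)
  have hnext (n : ℕ) : ∃ m, n < m ∧ closure (V n) ⊆ V m := by
    obtain ⟨m, hm⟩ := (hVc n).elim_directed_cover V hVo (by rw [hVcover]; exact subset_univ _)
      hVmono.directed_le
    exact ⟨max m (n + 1), by omega, hm.trans (hVmono (le_max_left _ _))⟩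
  choose f hf hfV using hnext
  set i : ℕ → ℕ := fun n ↦ f^[n] 0
  have hi (n : ℕ) : i (n + 1) = f (i n) := Function.iterate_succ_apply' f n 0
  have hle (n : ℕ) : n ≤ i n := by
    induction n with
    | zero => exact Nat.zero_le _
    | succ n ih =>
      rw [hi]
      have := hf (i n)
      omega
  have hint (n : ℕ) : interior (closure (V n)) = V n :=
    hS.interior_closure_surfaceInterior (hU n)
  refine ⟨S, hS, fun n ↦ closure (V (i n)), fun n ↦ hVc _, fun n ↦ ?_, ?_, fun n ↦ ?_⟩
  · rw [hint, hi]
    exact hfV _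
  · refine eq_univ_of_forall fun p ↦ ?_
    obtain ⟨n, hn⟩ := mem_iUnion.1 (hVcover ▸ mem_univ p)
    exact mem_iUnion.2 ⟨n, subset_closure (hVmono (hle n) hn)⟩
  · rw [hint]
    have h := hS.isCauchySurface_surfaceInterior (U (i n))
    exact ⟨⟨_, h⟩, h⟩
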